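/- Let $W$ be a non-trivial finite subgroup of $\mathrm{GL}(V_{\mathbb R})$, $V_{\mathbb R}\cong\mathbb R^\ell$, which is generated by reflections and acts irreducibly, and let $(\cdot,\cdot)$ be a $W$-invariant Euclidean inner product on $V_{\mathbb R}$. Let $V=V_{\mathbb R}\otimes_{\mathbb R}\mathbb C$, let $S=\mathbb C[V]=\mathbb C[x_1,\dots,x_\ell]$ for linear coordinates $x_1,\dots,x_\ell$ on $V_{\mathbb R}$, and let $R=S^W$. Let $p_1,\dots,p_\ell\in R$ be any homogeneous basic invariants, that is, homogeneous algebraically independent polynomials with $R=\mathbb C[p_1,\dots,p_\ell]$, of degrees $w_i=\deg p_i=m_i+1$ with $m_1\le\dots\le m_\ell$. Let $F\subset S$ be the ideal generated by the $W$-invariants without constant term. Let $\eta_j=\sum_{i,k}(x_i,x_k)\,\partial_{x_k}(p_j)\,\partial_{x_i}$ be the vector field that corresponds to $dp_j$ under the identification of $V$ and $V^*$ given by the inner product, and for $p\in S$ let $\mathrm{Hess}(p)\colon\mathrm{Der}_S\to\Omega^1_S$, $\mathrm{Hess}(p)(\delta)=\sum_{i=1}^\ell\delta(\partial_{x_i}(p))\,dx_i$.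 If $W$ is not of type $E_6$, $E_7$ or $E_8$, then the Hessian rank condition holds: for every $j\in\{1,\dots,\ell\}$ there is an $i\in\{1,\dots,\ell\}$ such that $m_i+m_j=w_\ell$ and $\mathrm{Hess}(p_i)(\eta_j)\notin F\,\Omega^1_S$. -/

import Mathlib

open MvPolynomial
open scoped KaehlerDifferential

noncomputable section

namespace CoxeterArrangement

variable {ℓ : ℕ}

/-- A reflection of `V_ℝ = ℝ^ℓ`: an involution `g` such that `g - 1` has rank one, that is, whose
fixed space is a hyperplane. -/
def IsReflection (g : GL (Fin ℓ) ℝ) : Prop :=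
  g * g = 1 ∧ ((g : Matrix (Fin ℓ) (Fin ℓ) ℝ) - 1).rank = 1

/-- A finite subgroup of `GL(V_ℝ)` generated by reflections. -/
structure IsReflectionGroup (W : Subgroup (GL (Fin ℓ) ℝ)) : Prop where
  finite : Finite W
  closure_eq : Subgroup.closure {g : GL (Fin ℓ) ℝ | g ∈ W ∧ IsReflection g} = W

/-- `W` is nontrivial and `V_ℝ = ℝ^ℓ` has no invariant subspace other than `0` and itself. (The
trivial group acting on a line has no reflections, and is not counted as irreducible.) -/
structure IsIrreducible (W : Subgroup (GL (Fin ℓ) ℝ)) : Prop where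
  ne_bot : W ≠ ⊥
  eq_bot_or_eq_top : ∀ U : Submodule ℝ (Fin ℓ → ℝ),
    (∀ w ∈ W, ∀ v ∈ U, (w : Matrix (Fin ℓ) (Fin ℓ) ℝ).mulVec v ∈ U) → U = ⊥ ∨ U = ⊤

/-- `G` is the Gram matrix of a `W`-invariant Euclidean inner product on `V_ℝ = ℝ^ℓ`. -/
structure IsInvariantInnerProduct (W : Subgroup (GL (Fin ℓ) ℝ))
    (G : Matrix (Fin ℓ) (Fin ℓ) ℝ) : Prop where
  posDef : G.PosDef
  invariant : ∀ w ∈ W, (w : Matrix (Fin ℓ) (Fin ℓ) ℝ).transpose * G * w = G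

/-- The inner product on `V_ℝ = ℝ^ℓ` with Gram matrix `G`. -/
def innerProd (G : Matrix (Fin ℓ) (Fin ℓ) ℝ) (u v : Fin ℓ → ℝ) : ℝ :=
  u ⬝ᵥ G.mulVec v

/-- `W` is of the type given by the Coxeter matrix `M`: there are simple roots `α b`, which are unit
vectors with `(α b, α b') = -cos (π / M b b')`, such that `W` is generated by the orthogonal
reflections `v ↦ v - 2 (v, α b) α b`. (Only used for Coxeter matrices without entry `∞`. Note that
`M b b = 1`, so that the condition includes `(α b, α b) = 1`.) -/
def IsOfType {B : Type*} (W : Subgroup (GL (Fin ℓ) ℝ)) (G : Matrix (Fin ℓ) (Fin ℓ) ℝ)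
    (M : CoxeterMatrix B) : Prop :=
  ∃ α : B → Fin ℓ → ℝ,
    (∀ b b', innerProd G (α b) (α b') = -Real.cos (Real.pi / (M b b' : ℝ))) ∧
    Subgroup.closure {g : GL (Fin ℓ) ℝ | ∃ b, ∀ v : Fin ℓ → ℝ,
      (g : Matrix (Fin ℓ) (Fin ℓ) ℝ).mulVec v = v - (2 * innerProd G v (α b)) • α b} = W

/-- The action of `w` on `S = ℂ[x₁, …, x_ℓ]`: `(w f)(v) = f (w⁻¹ v)`. -/
def contragredient (w : GL (Fin ℓ) ℝ) :
    MvPolynomial (Fin ℓ) ℂ →ₐ[ℂ] MvPolynomial (Fin ℓ) ℂ :=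
  aeval fun i => ∑ j, C ((((w⁻¹ : GL (Fin ℓ) ℝ) : Matrix (Fin ℓ) (Fin ℓ) ℝ) i j : ℝ) : ℂ) * X j

/-- The ring of invariants `R = S^W`. -/
def invariants (W : Subgroup (GL (Fin ℓ) ℝ)) : Subalgebra ℂ (MvPolynomial (Fin ℓ) ℂ) where
  carrier := {f | ∀ w ∈ W, contragredient w f = f}
  mul_mem' hf hg w hw := by rw [map_mul, hf w hw, hg w hw]
  add_mem' hf hg w hw := by rw [map_add, hf w hw, hg w hw]
  algebraMap_mem' c w _ := AlgHom.commutes (contragredient w) c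

/-- The ideal `F = S · 𝔪_R` of `S` generated by the invariants without constant term. -/
def invariantIdeal (W : Subgroup (GL (Fin ℓ) ℝ)) : Ideal (MvPolynomial (Fin ℓ) ℂ) :=
  Ideal.span {f | f ∈ invariants W ∧ constantCoeff f = 0}

/-- `p₁, …, p_ℓ` are homogeneous basic invariants of `W`, that is, `R = ℂ[p₁, …, p_ℓ]` is a
polynomial algebra, with `deg pᵢ = mᵢ + 1` and `m₁ ≤ ⋯ ≤ m_ℓ`. -/
structure IsBasicInvariants (W : Subgroup (GL (Fin ℓ) ℝ))
    (p : Fin ℓ → MvPolynomial (Fin ℓ) ℂ) (m : Fin ℓ → ℕ) : Prop where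
  isHomogeneous : ∀ i, (p i).IsHomogeneous (m i + 1)
  algebraicIndependent : AlgebraicIndependent ℂ p
  adjoin_eq : Algebra.adjoin ℂ (Set.range p) = invariants W
  monotone : Monotone m

/-- The vector field on `V` that corresponds to the 1-form `dp` under the identification of `V` and
`V*` by the inner product: its `i`-th coefficient is `∑ₖ (xᵢ, xₖ) ∂ₖ p`, where the matrix of the
inner product on `V*` is the inverse of the matrix `G` of the inner product on `V`. -/
def gradField (G : Matrix (Fin ℓ) (Fin ℓ) ℝ) (p : MvPolynomial (Fin ℓ) ℂ) :
    Derivation ℂ (MvPolynomial (Fin ℓ) ℂ) (MvPolynomial (Fin ℓ) ℂ) :=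
  mkDerivation ℂ fun i => ∑ k, C ((G⁻¹ i k : ℝ) : ℂ) * pderiv k p

/-- The Hessian `Hess(p) : Der_S → Ω¹_S`, `δ ↦ ∑ᵢ δ(∂ᵢ p) dxᵢ`. -/
def hess (p : MvPolynomial (Fin ℓ) ℂ) :
    Derivation ℂ (MvPolynomial (Fin ℓ) ℂ) (MvPolynomial (Fin ℓ) ℂ)
      →ₗ[MvPolynomial (Fin ℓ) ℂ] Ω[MvPolynomial (Fin ℓ) ℂ⁄ℂ] where
  toFun δ := ∑ i, δ (pderiv i p) • KaehlerDifferential.D ℂ (MvPolynomial (Fin ℓ) ℂ) (X i)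
  map_add' δ ε := by simp [add_smul, Finset.sum_add_distrib]
  map_smul' f δ := by simp [mul_smul, Finset.smul_sum]

/-- The Hessian rank condition for basic invariants `p` with exponents `m`: for any `j` there is an
`i` such that `mᵢ + mⱼ = w_ℓ = m_ℓ + 1` and `Hess(pᵢ)(ηⱼ) ∉ F Ω¹_S`, where `ηⱼ` is the vector field
that corresponds to `dpⱼ`. Here `⊤` is the last index. -/
def HessianRankCondition [NeZero ℓ] (W : Subgroup (GL (Fin ℓ) ℝ))
    (G : Matrix (Fin ℓ) (Fin ℓ) ℝ) (p : Fin ℓ → MvPolynomial (Fin ℓ) ℂ) (m : Fin ℓ → ℕ) : Prop :=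
  ∀ j, ∃ i, m i + m j = m ⊤ + 1 ∧
    hess (p i) (gradField G (p j)) ∉
      invariantIdeal W • (⊤ : Submodule (MvPolynomial (Fin ℓ) ℂ) Ω[MvPolynomial (Fin ℓ) ℂ⁄ℂ])

end CoxeterArrangement

end

/-!
The Hessian rank condition holds for every irreducible finite reflection group, by an argument that
does not use the classification.

Let `v` be an eigenvector of some `w ∈ W` on the complexification, whose eigenvalue `ζ` is a primitive
`n`-th root of unity. On the line of `v` an invariant is a polynomial in the `n`-th power of the
coordinate, so that elements of `F` of degree less than `n` vanish at `v`
(`eval_eq_zero_of_mem_invariantIdeal`). If `mᵢ + mⱼ = n`, then the coefficients `ηⱼ(∂ₖ pᵢ)` of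
`Hess(pᵢ)(ηⱼ)` have degree `n - 1`. If they belong to `F`, they vanish at `v`, and contraction with `v`
gives `mᵢ ηⱼ(pᵢ)(v) = 0` by Euler's identity (`IsBasicInvariants.sum_mul_eval_gradField`). As there
are no invariant linear forms, `mᵢ > 0`. So it suffices that `n = m_ℓ + 1`, and that for each `j` there
is an `i` with `mᵢ + mⱼ = n` and `ηⱼ(pᵢ)(v) ≠ 0`.

Suppose that the Jacobian determinant `J` of `p₁, …, p_ℓ` does not vanish at `v`. Then the matrix of
the values `ηⱼ(pᵢ)(v) = (dpᵢ, dpⱼ)(v)` is invertible, and some permutation `σ` picks out nonzero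
entries. Invariance under `w` gives `n ∣ mᵢ + m_{σ i}`, hence `2 ∑ mᵢ ≥ ℓ n`, and if also
`2 ∑ mᵢ ≤ ℓ n`, then `mᵢ + m_{σ i} = n` for all `i`
(`IsBasicInvariants.exists_dual_exponent`, `IsBasicInvariants.top_exponent`).

Two facts remain. First, `J` divides the product of the linear forms of the positive roots
(`IsBasicInvariants.jacobianDet_dvd_prod_roots`), so that `∑ mᵢ` is at most their number, and
`J(v) ≠ 0` if no root vanishes at `v`. This follows by differentiating `∏ (L - L') = 0`, in which `L'`
runs through the orbit of a linear form `L`: it shows that `J` divides the product of the "differents"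
`∏_{L' ≠ L} (L - L')` of any basis of linear forms, and suitable bases show that the prime factors of
`J` are roots and occur only once. Second, there is such an eigenvector, on which no root vanishes,
with `n` times `ℓ` at least the number of roots (`IsUnitRootSystem.exists_coxeter_plane`). This is
Steinberg's construction of the Coxeter plane: the Coxeter graph is a forest and hence
two-colourable, the products `s` and `t` of the reflections of either colour act as reflections on a
plane obtained from the Perron–Frobenius eigenvector of the Gram matrix, and `t s` is a rotation of
this plane by `2π / n`. The roots are counted by the lines of the plane on which they vanish.
-/

noncomputable section

namespace CoxeterArrangement

/-! ### Finite root systems and simple roots -/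

section Roots

variable {V : Type*} [AddCommGroup V] [Module ℝ V]

/-- The linear map `x ↦ x - 2 B(x, a) a`. It is the orthogonal reflection with root `a` if
`B(a, a) = 1`. -/
def rootReflection (B : LinearMap.BilinForm ℝ V) (a : V) : Module.End ℝ V :=
  LinearMap.id - (2 : ℝ) • (B.flip a).smulRight a

theorem rootReflection_apply (B : LinearMap.BilinForm ℝ V) (a x : V) :
    rootReflection B a x = x - (2 * B x a) • a := by
  simp [rootReflection, smul_smul]

/-- `Φ` is the set of unit roots of a finite reflection group on the Euclidean space `(V, B)`.
Unlike Mathlib's `RootPairing`, every root has length one, and there is no integrality condition. -/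
structure IsUnitRootSystem (B : LinearMap.BilinForm ℝ V) (Φ : Finset V) : Prop where
  symm : ∀ x y, B x y = B y x
  pos : ∀ x, x ≠ 0 → 0 < B x x
  unit : ∀ a ∈ Φ, B a a = 1
  reflection_mem : ∀ a ∈ Φ, ∀ b ∈ Φ, rootReflection B a b ∈ Φ

/-- `Δ` is a system of simple roots of `Φ`, with positive roots the roots on which the functional
`f` is positive. -/
structure IsSimpleSystem (B : LinearMap.BilinForm ℝ V) (Φ : Finset V) (f : V →ₗ[ℝ] ℝ)
    (Δ : Finset V) : Prop where
  subset : Δ ⊆ Φ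
  pos : ∀ a ∈ Δ, 0 < f a
  obtuse : ∀ a ∈ Δ, ∀ b ∈ Δ, a ≠ b → B a b ≤ 0
  indep : ∀ c : V → ℝ, ∑ a ∈ Δ, c a • a = 0 → ∀ a ∈ Δ, c a = 0
  exists_coeff : ∀ β ∈ Φ, 0 < f β → ∃ c : V → ℝ, (∀ a, 0 ≤ c a) ∧ β = ∑ a ∈ Δ, c a • a

variable {B : LinearMap.BilinForm ℝ V} {Φ : Finset V}

namespace IsUnitRootSystem

theorem ne_zero (h : IsUnitRootSystem B Φ) {a : V} (ha : a ∈ Φ) : a ≠ 0 := by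
  rintro rfl
  simpa using h.unit 0 ha

theorem neg_mem (h : IsUnitRootSystem B Φ) {a : V} (ha : a ∈ Φ) : -a ∈ Φ := by
  have := h.reflection_mem a ha a ha
  rw [rootReflection_apply, h.unit a ha] at this
  convert this using 1
  module

/-- A set of vectors with pairwise nonpositive inner products in an open half space is linearly
independent. -/
theorem indep_of_obtuse (h : IsUnitRootSystem B Φ) {f : V →ₗ[ℝ] ℝ} {Δ : Finset V}
    (hpos : ∀ a ∈ Δ, 0 < f a) (hobt : ∀ a ∈ Δ, ∀ b ∈ Δ, a ≠ b → B a b ≤ 0)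
    (c : V → ℝ) (hc : ∑ a ∈ Δ, c a • a = 0) : ∀ a ∈ Δ, c a = 0 := by
  -- The positive part `x` of the relation equals its negative part, so that `B x x ≤ 0`.
  set x := ∑ a ∈ Δ, (c a)⁺ • a with hx
  have hx' : x = ∑ a ∈ Δ, (c a)⁻ • a := by
    rw [← sub_eq_zero, hx, ← Finset.sum_sub_distrib, ← hc]
    refine Finset.sum_congr rfl fun a _ => ?_
    rw [← sub_smul, posPart_sub_negPart]
  have hxx : B x x ≤ 0 := by
    nth_rewrite 2 [hx']
    rw [hx]
    simp only [map_sum, LinearMap.sum_apply, map_smul, LinearMap.smul_apply, smul_eq_mul]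
    refine Finset.sum_nonpos fun a ha => ?_
    rw [Finset.mul_sum]
    refine Finset.sum_nonpos fun b hb => ?_
    rcases eq_or_ne a b with rfl | hab
    · have : (c a)⁻ * (c a)⁺ = 0 := by
        rcases le_total 0 (c a) with h0 | h0
        · simp [negPart_eq_zero.2 h0]
        · simp [posPart_eq_zero.2 h0]
      rw [← mul_assoc, this, zero_mul]
    · have := hobt _ hb _ ha (Ne.symm hab)
      have h1 := negPart_nonneg (c a)
      have h2 := posPart_nonneg (c b)
      exact mul_nonpos_of_nonneg_of_nonpos h1 (mul_nonpos_of_nonneg_of_nonpos h2 this)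
  have hx0 : x = 0 := by
    by_contra hne
    exact absurd (h.pos x hne) (not_lt.2 hxx)
  have key : ∀ d : V → ℝ, (∀ a, 0 ≤ d a) → ∑ a ∈ Δ, d a • a = 0 → ∀ a ∈ Δ, d a = 0 := by
    intro d hd hs a ha
    have h1 : ∑ a ∈ Δ, d a * f a = 0 := by
      have := congrArg f hs
      simpa [map_sum] using this
    have h2 := (Finset.sum_eq_zero_iff_of_nonneg
      (fun a ha => mul_nonneg (hd a) (hpos a ha).le)).1 h1 a ha
    rcases mul_eq_zero.1 h2 with h3 | h3
    · exact h3
    · exact absurd h3 (hpos a ha).ne'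
  intro a ha
  have h1 := key (fun a => (c a)⁺) (fun a => posPart_nonneg _) (hx ▸ hx0) a ha
  have h2 := key (fun a => (c a)⁻) (fun a => negPart_nonneg _) (hx' ▸ hx0) a ha
  rw [← posPart_sub_negPart (c a)]
  rw [h1, h2, sub_zero]

/-- A minimal set of positive roots whose cone contains all positive roots is a system of simple
roots. -/
theorem exists_isSimpleSystem (h : IsUnitRootSystem B Φ) :
    ∃ (f : V →ₗ[ℝ] ℝ) (Δ : Finset V), (∀ β ∈ Φ, f β ≠ 0) ∧ IsSimpleSystem B Φ f Δ := by
  classical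
  obtain ⟨f, hf⟩ := Module.exists_dual_forall_apply_ne_zero (K := ℝ) (fun a : Φ => (a : V))
    (fun a => h.ne_zero a.2)
  have hf' : ∀ β ∈ Φ, f β ≠ 0 := fun β hβ => hf ⟨β, hβ⟩
  let cone : Finset V → V → Prop := fun Δ β =>
    ∃ c : V → ℝ, (∀ a, 0 ≤ c a) ∧ β = ∑ a ∈ Δ, c a • a
  let P : Finset V → Prop := fun Δ =>
    Δ ⊆ Φ.filter (fun β => 0 < f β) ∧ ∀ β ∈ Φ, 0 < f β → cone Δ β
  have hP : P (Φ.filter (fun β => 0 < f β)) := by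
    refine ⟨subset_rfl, fun β hβ hpos => ⟨fun a => if a = β then 1 else 0, ?_, ?_⟩⟩
    · intro a; dsimp only; split_ifs <;> norm_num
    · simp [Finset.sum_ite_eq', hβ, hpos]
  obtain ⟨Δ, -, hΔ⟩ := exists_minimal_le_of_wellFoundedLT P _ hP
  have hsub : ∀ a ∈ Δ, a ∈ Φ ∧ 0 < f a := fun a ha => by
    simpa using hΔ.prop.1 ha
  -- By minimality no element of `Δ` is in the cone of the others.
  have hmin : ∀ a ∈ Δ, ¬ cone (Δ.erase a) a := by
    rintro a ha ⟨c, hc, hac⟩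
    have : P (Δ.erase a) := by
      refine ⟨(Finset.erase_subset _ _).trans hΔ.prop.1, fun β hβ hpos => ?_⟩
      obtain ⟨d, hd, hβd⟩ := hΔ.prop.2 β hβ hpos
      refine ⟨fun b => d b + d a * c b, fun b => add_nonneg (hd b) (mul_nonneg (hd a) (hc b)), ?_⟩
      rw [hβd, ← Finset.add_sum_erase _ _ ha]
      nth_rewrite 2 [hac]
      simp only [add_smul, mul_smul, Finset.sum_add_distrib, Finset.smul_sum]
      abel
    have h2 := hΔ.le_of_le this (Finset.erase_subset _ _)
    exact Finset.notMem_erase a Δ (h2 ha)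
  -- A positive multiple of `a ∈ Δ` does not lie in the cone of `Δ` shifted by a nonzero combination
  -- `w` of the other elements: either `a` would be in the cone of the others, or a sum of positive
  -- vectors would vanish.
  have key : ∀ a ∈ Δ, ∀ (x : ℝ) (d : V → ℝ), (∀ b, 0 ≤ d b) → 0 < x →
      ∀ w : V → ℝ, (∀ b, 0 ≤ w b) → (∃ b ∈ Δ, 0 < w b) → w a = 0 →
      x • a ≠ ∑ b ∈ Δ, d b • b + ∑ b ∈ Δ, w b • b := by
    intro a ha x d hd hx w hw ⟨b, hb, hwb⟩ hwa heq
    rcases lt_or_ge (d a) x with hlt | hge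
    · refine hmin a ha ⟨fun b => (x - d a)⁻¹ * (d b + w b), fun b => ?_, ?_⟩
      · have := hd b
        have := hw b
        have : 0 < x - d a := by linarith
        positivity
      · have h1 : (x - d a) • a = ∑ b ∈ Δ.erase a, (d b + w b) • b := by
          rw [sub_smul, heq, ← Finset.sum_add_distrib, ← Finset.add_sum_erase _ _ ha, hwa,
            zero_smul]
          simp only [add_smul]
          abel
        have h2 : x - d a ≠ 0 := by linarith
        simp only [mul_smul]
        rw [← Finset.smul_sum, ← h1, smul_smul, inv_mul_cancel₀ h2, one_smul]
    · have h1 := congrArg f heq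
      simp only [map_add, map_sum, map_smul, smul_eq_mul] at h1
      have h2 : d a * f a ≤ ∑ b ∈ Δ, d b * f b :=
        Finset.single_le_sum (f := fun b => d b * f b)
          (fun b hb => mul_nonneg (hd b) (hsub b hb).2.le) ha
      have h3 : w b * f b ≤ ∑ b ∈ Δ, w b * f b :=
        Finset.single_le_sum (f := fun b => w b * f b)
          (fun b hb => mul_nonneg (hw b) (hsub b hb).2.le) hb
      have h4 := mul_pos hwb (hsub b hb).2
      have h5 := mul_le_mul_of_nonneg_right hge (hsub a ha).2.le
      linarith
  have hobt : ∀ a ∈ Δ, ∀ b ∈ Δ, a ≠ b → B a b ≤ 0 := by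
    intro a ha b hb hab
    by_contra! hpos
    have hr := h.reflection_mem a (hsub a ha).1 b (hsub b hb).1
    rw [rootReflection_apply, h.symm b a] at hr
    rcases lt_or_gt_of_ne (hf' _ hr) with hneg | hpos'
    · have hr' := h.neg_mem hr
      obtain ⟨c, hc, hβ⟩ := hΔ.prop.2 _ hr' (by rw [map_neg]; linarith)
      refine key a ha (2 * B a b) c hc (by linarith) (fun x => if x = b then 1 else 0) ?_
        ⟨b, hb, by simp⟩ (by simp [hab]) ?_
      · intro x; split_ifs <;> norm_num
      · rw [← hβ]; simp [hb]
    · obtain ⟨c, hc, hβ⟩ := hΔ.prop.2 _ hr hpos'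
      refine key b hb 1 c hc one_pos (fun x => if x = a then 2 * B a b else 0) ?_
        ⟨a, ha, by simpa using hpos⟩ (by simp [hab.symm]) ?_
      · intro x; split_ifs <;> linarith
      · rw [← hβ]; simp [ha]
  exact ⟨f, Δ, hf', ⟨fun a ha => (hsub a ha).1, fun a ha => (hsub a ha).2, hobt,
    h.indep_of_obtuse (fun a ha => (hsub a ha).2) hobt, hΔ.prop.2⟩⟩

end IsUnitRootSystem

namespace IsSimpleSystem

variable {f : V →ₗ[ℝ] ℝ} {Δ : Finset V}

/-- The coefficients of a root with respect to the simple roots all have the same sign. -/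
theorem coeff_sign (hΔ : IsSimpleSystem B Φ f Δ) (h : IsUnitRootSystem B Φ)
    (hf : ∀ β ∈ Φ, f β ≠ 0) {c : V → ℝ} (hc : ∑ a ∈ Δ, c a • a ∈ Φ) :
    (∀ a ∈ Δ, 0 ≤ c a) ∨ (∀ a ∈ Δ, c a ≤ 0) := by
  rcases lt_or_gt_of_ne (hf _ hc) with hneg | hpos
  · obtain ⟨d, hd, hβ⟩ := hΔ.exists_coeff _ (h.neg_mem hc) (by rw [map_neg]; linarith)
    right
    intro a ha
    have := hΔ.indep (fun a => c a + d a)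
      (by simp only [add_smul, Finset.sum_add_distrib]; rw [← hβ]; abel) a ha
    have := hd a
    linarith
  · obtain ⟨d, hd, hβ⟩ := hΔ.exists_coeff _ hc hpos
    left
    intro a ha
    have := hΔ.indep (fun a => c a - d a)
      (by simp only [sub_smul, Finset.sum_sub_distrib]; rw [← hβ]; abel) a ha
    have := hd a
    linarith

/-- Simple roots that are not orthogonal enclose an angle of at least `2π/3`. -/
theorem inner_le_neg_half (hΔ : IsSimpleSystem B Φ f Δ) (h : IsUnitRootSystem B Φ)
    (hf : ∀ β ∈ Φ, f β ≠ 0) {a b : V} (ha : a ∈ Δ) (hb : b ∈ Δ) (hab : a ≠ b)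
    (h0 : B a b ≠ 0) : B a b ≤ -1 / 2 := by
  classical
  have hlt : B a b < 0 := lt_of_le_of_ne (hΔ.obtuse a ha b hb hab) h0
  have ha' := hΔ.subset ha
  have hb' := hΔ.subset hb
  have hmem := h.reflection_mem a ha' _ (h.reflection_mem b hb' a ha')
  have heq : rootReflection B a (rootReflection B b a) =
      ∑ x ∈ Δ, ((if x = a then 4 * B a b ^ 2 - 1 else 0) + (if x = b then -2 * B a b else 0)) • x := by
    simp only [add_smul, Finset.sum_add_distrib, ite_smul, zero_smul, Finset.sum_ite_eq', ha, hb,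
      if_true]
    simp only [rootReflection_apply, map_sub, map_smul, h.symm b a, h.unit a ha']
    module
  rw [heq] at hmem
  rcases hΔ.coeff_sign h hf hmem with hs | hs
  · have := hs a ha
    simp only [if_true, if_neg hab, add_zero] at this
    nlinarith
  · have := hs b hb
    simp only [if_true, if_neg hab.symm, zero_add] at this
    linarith

/-- A nonempty set of simple roots has a member that is orthogonal to all others but at most one:
the Coxeter graph is a forest. -/
theorem exists_leaf (hΔ : IsSimpleSystem B Φ f Δ) (h : IsUnitRootSystem B Φ)
    (hf : ∀ β ∈ Φ, f β ≠ 0) {T : Finset V} (hT : T ⊆ Δ) (hne : T.Nonempty) :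
    ∃ a ∈ T, ∀ b ∈ T, ∀ c ∈ T, b ≠ a → c ≠ a → B a b ≠ 0 → B a c ≠ 0 → b = c := by
  classical
  by_contra! hcon
  -- Otherwise the sum `x` of the roots in `T` has `B x x ≤ 0`.
  have hle : B (∑ a ∈ T, a) (∑ a ∈ T, a) ≤ 0 := by
    simp only [map_sum, LinearMap.sum_apply]
    rw [Finset.sum_comm]
    refine Finset.sum_nonpos fun a ha => ?_
    obtain ⟨b, hb, c, hc, hba, hca, hab, hac, hbc⟩ := hcon a ha
    have hb2 := hΔ.inner_le_neg_half h hf (hT ha) (hT hb) hba.symm hab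
    have hc2 := hΔ.inner_le_neg_half h hf (hT ha) (hT hc) hca.symm hac
    have h3 : ({a, b, c} : Finset V) ⊆ T := by
      intro x hx
      simp only [Finset.mem_insert, Finset.mem_singleton] at hx
      rcases hx with rfl | rfl | rfl <;> assumption
    rw [← Finset.sum_sdiff h3]
    have h4 : ∑ x ∈ T \ {a, b, c}, B a x ≤ 0 := by
      refine Finset.sum_nonpos fun x hx => ?_
      simp only [Finset.mem_sdiff, Finset.mem_insert, not_or] at hx
      exact hΔ.obtuse a (hT ha) x (hT hx.1) (Ne.symm hx.2.1)
    have h5 : ∑ x ∈ ({a, b, c} : Finset V), B a x = B a a + (B a b + B a c) := by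
      rw [Finset.sum_insert (by simp [hba.symm, hca.symm]), Finset.sum_pair hbc]
    rw [h5, h.unit a (hΔ.subset (hT ha))]
    linarith
  have h0 : ∑ a ∈ T, a = 0 := by
    by_contra hne0
    exact absurd (h.pos _ hne0) (not_lt.2 hle)
  have hf0 := congrArg f h0
  rw [map_sum, map_zero] at hf0
  exact absurd hf0 (Finset.sum_pos (fun a ha => hΔ.pos a (hT ha)) hne).ne'

theorem exists_coloring (hΔ : IsSimpleSystem B Φ f Δ) (h : IsUnitRootSystem B Φ)
    (hf : ∀ β ∈ Φ, f β ≠ 0) {T : Finset V} (hT : T ⊆ Δ) :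
    ∃ col : V → Bool, ∀ a ∈ T, ∀ b ∈ T, a ≠ b → B a b ≠ 0 → col a ≠ col b := by
  classical
  induction hn : T.card generalizing T with
  | zero =>
    rw [Finset.card_eq_zero] at hn
    subst hn
    exact ⟨fun _ => true, by simp⟩
  | succ n ih =>
    obtain ⟨a, ha, hleaf⟩ := hΔ.exists_leaf h hf hT (Finset.card_pos.1 (by omega))
    obtain ⟨col, hcol⟩ := ih ((Finset.erase_subset a T).trans hT)
      (by rw [Finset.card_erase_of_mem ha, hn]; rfl)
    by_cases hnb : ∃ b ∈ T, b ≠ a ∧ B a b ≠ 0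
    · obtain ⟨b, hb, hba, hab⟩ := hnb
      refine ⟨Function.update col a (!col b), ?_⟩
      have hupd : ∀ y ∈ T, y ≠ a → B a y ≠ 0 →
          Function.update col a (!col b) a ≠ Function.update col a (!col b) y := by
        intro y hy hya hay
        rw [hleaf y hy b hb hya hba hay hab]
        simp [hba]
      intro x hx y hy hxy h0
      by_cases hxa : x = a
      · subst hxa
        exact hupd y hy hxy.symm h0
      by_cases hya : y = a
      · subst hya
        exact (hupd x hx hxy (by rwa [h.symm])).symm
      rw [Function.update_of_ne hxa, Function.update_of_ne hya]
      exact hcol x (Finset.mem_erase.2 ⟨hxa, hx⟩) y (Finset.mem_erase.2 ⟨hya, hy⟩) hxy h0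
    · push Not at hnb
      refine ⟨col, fun x hx y hy hxy h0 => ?_⟩
      by_cases hxa : x = a
      · subst hxa
        exact absurd (hnb y hy hxy.symm) h0
      by_cases hya : y = a
      · subst hya
        exact absurd (hnb x hx hxy) (by rwa [h.symm])
      exact hcol x (Finset.mem_erase.2 ⟨hxa, hx⟩) y (Finset.mem_erase.2 ⟨hya, hy⟩) hxy h0

/-- If the simple roots in `Z` are orthogonal to those outside `Z`, then every positive root is a
combination of simple roots of one kind only. -/
theorem coeff_eq_zero_of_orthogonal (hΔ : IsSimpleSystem B Φ f Δ) (h : IsUnitRootSystem B Φ)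
    (hf : ∀ β ∈ Φ, f β ≠ 0) {Z : Set V}
    (hZ : ∀ a ∈ Δ, ∀ b ∈ Δ, a ∈ Z → b ∉ Z → B a b = 0) {c : V → ℝ}
    (hc0 : ∀ a ∈ Δ, 0 ≤ c a) (hc : ∑ a ∈ Δ, c a • a ∈ Φ) :
    (∀ a ∈ Δ, a ∈ Z → c a = 0) ∨ (∀ a ∈ Δ, a ∉ Z → c a = 0) := by
  classical
  -- A mixed positive root can be reflected to a lower mixed positive root.
  by_contra hcon
  let S := Φ.filter fun β => ∃ c : V → ℝ, (∀ a ∈ Δ, 0 ≤ c a) ∧ β = ∑ a ∈ Δ, c a • a ∧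
    (∃ a ∈ Δ, a ∈ Z ∧ c a ≠ 0) ∧ ∃ a ∈ Δ, a ∉ Z ∧ c a ≠ 0
  have hS : S.Nonempty := by
    push Not at hcon
    exact ⟨_, Finset.mem_filter.2 ⟨hc, c, hc0, rfl, hcon.1, hcon.2⟩⟩
  obtain ⟨β, hβ, hmin⟩ := Finset.exists_min_image S f hS
  obtain ⟨hβΦ, c, hc0, rfl, ⟨x, hx, hxZ, hcx⟩, ⟨y, hy, hyZ, hcy⟩⟩ := Finset.mem_filter.1 hβ
  set β := ∑ a ∈ Δ, c a • a with hβdef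
  obtain ⟨a, ha, hβa⟩ : ∃ a ∈ Δ, 0 < B β a := by
    by_contra! hle
    have h1 : B β β ≤ 0 := by
      nth_rewrite 2 [hβdef]
      rw [map_sum]
      refine Finset.sum_nonpos fun a ha => ?_
      rw [map_smul, smul_eq_mul]
      exact mul_nonpos_of_nonneg_of_nonpos (hc0 a ha) (hle a ha)
    rw [h.unit β hβΦ] at h1
    linarith
  have hr := h.reflection_mem a (hΔ.subset ha) β hβΦ
  let d : V → ℝ := fun b => c b - if b = a then 2 * B β a else 0
  have hrd : rootReflection B a β = ∑ b ∈ Δ, d b • b := by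
    simp only [d, sub_smul, Finset.sum_sub_distrib, ite_smul, zero_smul, Finset.sum_ite_eq', ha,
      if_true]
    rw [rootReflection_apply]
  have hdne : ∀ b, b ≠ a → d b = c b := fun b hb => by simp [d, hb]
  rw [hrd] at hr
  -- The coefficient at an index in the other part is unchanged and positive.
  have hd0 : ∀ b ∈ Δ, 0 ≤ d b := by
    rcases hΔ.coeff_sign h hf hr with hs | hs
    · exact hs
    · exfalso
      by_cases haZ : a ∈ Z
      · have h1 := hs y hy
        rw [hdne y (fun e => hyZ (e ▸ haZ))] at h1
        exact hcy (le_antisymm h1 (hc0 y hy))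
      · have h1 := hs x hx
        rw [hdne x (fun e => haZ (e ▸ hxZ))] at h1
        exact hcx (le_antisymm h1 (hc0 x hx))
  have hlow : f (∑ b ∈ Δ, d b • b) < f β := by
    rw [← hrd, rootReflection_apply, map_sub, map_smul, smul_eq_mul]
    have := mul_pos hβa (hΔ.pos a ha)
    linarith
  have hrS : ∑ b ∈ Δ, d b • b ∈ S := by
    refine Finset.mem_filter.2 ⟨hr, d, hd0, rfl, ?_, ?_⟩
    · by_contra! hall
      -- Then `a ∈ Z`, and the part of `β` in `Z` is the multiple `c a • a` of `a`.
      have haZ : a ∈ Z := by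
        by_contra haZ
        have := hall x hx hxZ
        rw [hdne x (fun e => haZ (e ▸ hxZ))] at this
        exact hcx this
      have hBa : B β a = c a := by
        rw [hβdef, map_sum, LinearMap.sum_apply, Finset.sum_eq_single a]
        · simp [h.unit a (hΔ.subset ha)]
        · intro b hb hba
          by_cases hbZ : b ∈ Z
          · have := hall b hb hbZ
            rw [hdne b hba] at this
            simp [this]
          · simp [h.symm b a, hZ a ha b hb haZ hbZ]
        · exact fun hna => absurd ha hna
      have h1 := hall a ha haZ
      simp only [d, if_true, hBa] at h1
      linarith
    · by_contra! hall
      have haZ : a ∉ Z := by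
        intro haZ
        have := hall y hy hyZ
        rw [hdne y (fun e => hyZ (e ▸ haZ))] at this
        exact hcy this
      have hBa : B β a = c a := by
        rw [hβdef, map_sum, LinearMap.sum_apply, Finset.sum_eq_single a]
        · simp [h.unit a (hΔ.subset ha)]
        · intro b hb hba
          by_cases hbZ : b ∈ Z
          · simp [hZ b hb a ha hbZ haZ]
          · have := hall b hb hbZ
            rw [hdne b hba] at this
            simp [this]
        · exact fun hna => absurd ha hna
      have h1 := hall a ha haZ
      simp only [d, if_true, hBa] at h1
      linarith
  exact absurd (hmin _ hrS) (not_le.2 hlow)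

/-- A positive root in the span of pairwise orthogonal simple roots is one of them. -/
theorem mem_of_orthogonal (hΔ : IsSimpleSystem B Φ f Δ) (h : IsUnitRootSystem B Φ)
    (hf : ∀ β ∈ Φ, f β ≠ 0) {J : Finset V}
    (horth : ∀ a ∈ J, ∀ b ∈ J, a ≠ b → B a b = 0) {c : V → ℝ}
    (hc0 : ∀ a ∈ Δ, 0 ≤ c a) (hc : ∑ a ∈ Δ, c a • a ∈ Φ) (hcJ : ∀ a ∈ Δ, a ∉ J → c a = 0) :
    ∑ a ∈ Δ, c a • a ∈ J := by
  classical
  have hex : ∃ a ∈ Δ, c a ≠ 0 := by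
    by_contra! hall
    refine h.ne_zero hc (Finset.sum_eq_zero fun a ha => by rw [hall a ha, zero_smul])
  obtain ⟨a, ha, hca⟩ := hex
  have haJ : a ∈ J := by
    by_contra haJ
    exact hca (hcJ a ha haJ)
  -- The reflection in `a` negates the coefficient of `a` and keeps the others, which thus vanish.
  set β := ∑ a ∈ Δ, c a • a with hβdef
  have hBa : B β a = c a := by
    rw [hβdef, map_sum, LinearMap.sum_apply, Finset.sum_eq_single a]
    · simp [h.unit a (hΔ.subset ha)]
    · intro b hb hba
      by_cases hbJ : b ∈ J
      · simp [horth b hbJ a haJ hba]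
      · simp [hcJ b hb hbJ]
    · exact fun hna => absurd ha hna
  have hr := h.reflection_mem a (hΔ.subset ha) β hc
  let d : V → ℝ := fun b => c b - if b = a then 2 * B β a else 0
  have hrd : rootReflection B a β = ∑ b ∈ Δ, d b • b := by
    simp only [d, sub_smul, Finset.sum_sub_distrib, ite_smul, zero_smul, Finset.sum_ite_eq', ha,
      if_true]
    rw [rootReflection_apply]
  rw [hrd] at hr
  have hpos : 0 < c a := lt_of_le_of_ne (hc0 a ha) hca.symm
  have hzero : ∀ b ∈ Δ, b ≠ a → c b = 0 := by
    intro b hb hba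
    rcases hΔ.coeff_sign h hf hr with hs | hs
    · have := hs a ha
      simp only [d, if_true, hBa] at this
      linarith
    · have := hs b hb
      simp only [d, if_neg hba, sub_zero] at this
      exact le_antisymm this (hc0 b hb)
  have hβ : β = c a • a := by
    rw [hβdef, Finset.sum_eq_single a]
    · intro b hb hba
      rw [hzero b hb hba, zero_smul]
    · exact fun hna => absurd ha hna
  have hu := h.unit β hc
  rw [hβ] at hu
  simp only [map_smul, LinearMap.smul_apply, smul_eq_mul, h.unit a (hΔ.subset ha), mul_one] at hu
  have h1 : c a = 1 := by nlinarith
  rw [hβ, h1, one_smul]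
  exact haJ

end IsSimpleSystem

end Roots

/-! ### A nonnegative symmetric matrix has a positive eigenvector -/

section PerronFrobenius

open Matrix in
/-- The Perron–Frobenius theorem for symmetric matrices: the eigenvector is found by maximising the
quadratic form on the unit sphere. -/
theorem exists_pos_eigenvector {ι : Type*} [Fintype ι] [Nonempty ι] (A : Matrix ι ι ℝ)
    (hsymm : Aᵀ = A) (hnn : ∀ i j, 0 ≤ A i j)
    (hconn : ∀ Z : Set ι, Z.Nonempty → (∀ i ∈ Z, ∀ j ∉ Z, A i j = 0) → Z = Set.univ) :
    ∃ (θ : ℝ) (c : ι → ℝ), 0 ≤ θ ∧ (∀ i, 0 < c i) ∧ A *ᵥ c = θ • c := by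
  classical
  let K : Set (ι → ℝ) := {x | x ⬝ᵥ x = 1}
  have hKc : IsCompact K := by
    refine IsCompact.of_isClosed_subset (isCompact_Icc (a := fun _ => (-1 : ℝ)) (b := fun _ => 1))
      (isClosed_eq (by fun_prop) continuous_const) fun x hx => ?_
    have hi : ∀ i, x i ^ 2 ≤ 1 := fun i => by
      have hx' : ∑ i, x i * x i = 1 := hx
      rw [← hx', sq]
      exact Finset.single_le_sum (f := fun i => x i * x i) (fun j _ => mul_self_nonneg _)
        (Finset.mem_univ i)
    exact ⟨fun i => (abs_le.1 ((sq_le_one_iff_abs_le_one _).1 (hi i))).1,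
      fun i => (abs_le.1 ((sq_le_one_iff_abs_le_one _).1 (hi i))).2⟩
  have hKn : K.Nonempty := ⟨Pi.single (Classical.arbitrary ι) 1, by simp [K]⟩
  obtain ⟨x, hxK, hmax⟩ := hKc.exists_isMaxOn hKn
    (f := fun x => x ⬝ᵥ A *ᵥ x) (by fun_prop)
  set θ := x ⬝ᵥ A *ᵥ x with hθ
  have hmax' : ∀ z : ι → ℝ, z ⬝ᵥ A *ᵥ z ≤ θ * (z ⬝ᵥ z) := by
    intro z
    rcases eq_or_ne z 0 with rfl | hz
    · simp
    have hpos : 0 < z ⬝ᵥ z := by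
      refine lt_of_le_of_ne (Finset.sum_nonneg fun i _ => mul_self_nonneg _) ?_
      exact fun h0 => hz (dotProduct_self_eq_zero.1 h0.symm)
    have hs := Real.mul_self_sqrt hpos.le
    have hs0 : Real.sqrt (z ⬝ᵥ z) ≠ 0 := (Real.sqrt_pos.2 hpos).ne'
    have hk : ((Real.sqrt (z ⬝ᵥ z))⁻¹ • z) ∈ K := by
      simp only [K, Set.mem_ofPred_eq, smul_dotProduct, dotProduct_smul, smul_eq_mul]
      nth_rewrite 3 [← hs]
      field_simp
    have := hmax hk
    simp only [Set.mem_ofPred_eq, smul_dotProduct, mulVec_smul, dotProduct_smul, smul_eq_mul] at this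
    rw [← mul_assoc, ← mul_inv, hs, inv_mul_le_iff₀ hpos] at this
    rw [hθ]
    linarith
  set y : ι → ℝ := fun i => |x i| with hy
  have hyK : y ⬝ᵥ y = 1 := by
    have hx' : ∑ i, x i * x i = 1 := hxK
    simpa [dotProduct, hy, abs_mul_abs_self] using hx'
  have hyθ : y ⬝ᵥ A *ᵥ y = θ := by
    refine le_antisymm (by simpa [hyK] using hmax' y) ?_
    rw [hθ]
    simp only [dotProduct, mulVec, Finset.mul_sum]
    refine Finset.sum_le_sum fun i _ => Finset.sum_le_sum fun j _ => ?_
    calc x i * (A i j * x j) ≤ |x i * (A i j * x j)| := le_abs_self _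
      _ = y i * (A i j * y j) := by simp [hy, abs_mul, abs_of_nonneg (hnn i j)]
  -- The first variation of the quadratic form `θ |z|² - (z, A z) ≥ 0` at its zero `y` vanishes.
  have heig : A *ᵥ y = θ • y := by
    ext i
    have hvar : ∀ t : ℝ, 0 ≤ (θ - A i i) * (t * t) + 2 * (θ * y i - (A *ᵥ y) i) * t + 0 := by
      intro t
      have h1 := hmax' (y + t • Pi.single i 1)
      have h2 : y ⬝ᵥ A *ᵥ Pi.single i 1 = (A *ᵥ y) i := by
        rw [dotProduct_mulVec, ← mulVec_transpose, hsymm, dotProduct_single_one]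
      simp only [mulVec_add, mulVec_smul, add_dotProduct, dotProduct_add, smul_dotProduct,
        dotProduct_smul, hyK, hyθ, h2, smul_eq_mul, single_one_dotProduct,
        dotProduct_single_one] at h1
      simp only [mulVec_single_one, col_apply, Pi.add_apply, Pi.smul_apply, Pi.single_eq_same,
        smul_eq_mul] at h1
      linarith
    have hd := discrim_le_zero hvar
    simp only [discrim, mul_zero, sub_zero] at hd
    have h0 := pow_eq_zero_iff (two_ne_zero) |>.1 (le_antisymm hd (sq_nonneg _))
    simp only [Pi.smul_apply, smul_eq_mul]
    linarith
  have hpos : ∀ i, 0 < y i := by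
    by_contra! hcon
    obtain ⟨i, hi⟩ := hcon
    have hZ := hconn {i | y i = 0} ⟨i, le_antisymm hi (abs_nonneg _)⟩ (by
      intro i hi j hj
      have h1 := congrFun heig i
      have hi' : y i = 0 := hi
      rw [Pi.smul_apply, hi', smul_zero] at h1
      have h2 := (Finset.sum_eq_zero_iff_of_nonneg
        (fun j _ => mul_nonneg (hnn i j) (abs_nonneg (x j)))).1 h1 j (Finset.mem_univ j)
      exact (mul_eq_zero.1 h2).resolve_right hj)
    have hy0 : y = 0 := funext fun j => by
      have : j ∈ {i | y i = 0} := hZ ▸ Set.mem_univ j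
      exact this
    rw [hy0] at hyK
    simp at hyK
  refine ⟨θ, y, ?_, hpos, heig⟩
  rw [← hyθ]
  exact Finset.sum_nonneg fun i _ => mul_nonneg (hpos i).le
    (Finset.sum_nonneg fun j _ => mul_nonneg (hnn i j) (hpos j).le)

end PerronFrobenius

/-! ### The Coxeter plane -/

section CoxeterPlane

variable {V : Type*} [AddCommGroup V] [Module ℝ V] {B : LinearMap.BilinForm ℝ V} {Φ : Finset V}

/-- The product of the commuting reflections in the pairwise orthogonal unit vectors in `J`. -/
def orthReflection (B : LinearMap.BilinForm ℝ V) (J : Finset V) : Module.End ℝ V :=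
  LinearMap.id - ∑ a ∈ J, (2 : ℝ) • (B.flip a).smulRight a

theorem orthReflection_apply (B : LinearMap.BilinForm ℝ V) (J : Finset V) (x : V) :
    orthReflection B J x = x - ∑ a ∈ J, (2 * B x a) • a := by
  simp [orthReflection, smul_smul]

theorem orthReflection_mem_closure {J : Finset V} (hJ : J ⊆ Φ)
    (horth : ∀ a ∈ J, ∀ b ∈ J, a ≠ b → B a b = 0) :
    orthReflection B J ∈ Submonoid.closure (rootReflection B '' (Φ : Set V)) := by
  classical
  induction J using Finset.induction_on with
  | empty =>
    have : orthReflection B ∅ = 1 := by ext x; simp [orthReflection]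
    rw [this]
    exact one_mem _
  | insert a J ha ih =>
    have heq : orthReflection B (insert a J) = rootReflection B a * orthReflection B J := by
      ext x
      have h0 : ∑ b ∈ J, 2 * B x b * B b a = 0 := Finset.sum_eq_zero fun b hb => by
        rw [horth b (Finset.mem_insert_of_mem hb) a (Finset.mem_insert_self a J)
          (fun e => ha (e ▸ hb)), mul_zero]
      rw [Module.End.mul_apply, rootReflection_apply, orthReflection_apply, orthReflection_apply,
        Finset.sum_insert ha]
      simp only [map_sub, map_sum, map_smul, LinearMap.sub_apply, LinearMap.sum_apply,
        LinearMap.smul_apply, smul_eq_mul, h0, sub_zero]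
      abel
    rw [heq]
    exact mul_mem (Submonoid.subset_closure ⟨a, hJ (Finset.mem_insert_self a J), rfl⟩)
      (ih (fun b hb => hJ (Finset.mem_insert_of_mem hb))
        fun b hb c hc => horth b (Finset.mem_insert_of_mem hb) c (Finset.mem_insert_of_mem hc))

namespace IsUnitRootSystem

theorem mem_of_mem_closure (h : IsUnitRootSystem B Φ) {g : Module.End ℝ V}
    (hg : g ∈ Submonoid.closure (rootReflection B '' (Φ : Set V))) : ∀ β ∈ Φ, g β ∈ Φ := by
  induction hg using Submonoid.closure_induction with
  | mem x hx =>
    obtain ⟨a, ha, rfl⟩ := hx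
    exact fun β hβ => h.reflection_mem a ha β hβ
  | one => exact fun β hβ => hβ
  | mul x y _ _ ihx ihy => exact fun β hβ => ihx _ (ihy β hβ)

theorem orthReflection_symm (h : IsUnitRootSystem B Φ) (J : Finset V) (x y : V) :
    B (orthReflection B J x) y = B x (orthReflection B J y) := by
  simp only [orthReflection_apply, map_sub, map_sum, map_smul, LinearMap.sub_apply,
    LinearMap.sum_apply, LinearMap.smul_apply, smul_eq_mul]
  congr 1
  refine Finset.sum_congr rfl fun a _ => ?_
  rw [h.symm a y]
  ring

theorem orthReflection_orthReflection (h : IsUnitRootSystem B Φ) {J : Finset V} (hJ : J ⊆ Φ)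
    (horth : ∀ a ∈ J, ∀ b ∈ J, a ≠ b → B a b = 0) (x : V) :
    orthReflection B J (orthReflection B J x) = x := by
  have hneg : ∀ a ∈ J, B (orthReflection B J x) a = -B x a := by
    intro a ha
    rw [h.orthReflection_symm, orthReflection_apply, Finset.sum_eq_single a]
    · simp only [h.unit a (hJ ha), map_sub, map_smul, smul_eq_mul]
      ring
    · intro b hb hba
      rw [horth a ha b hb hba.symm, mul_zero, zero_smul]
    · exact fun hna => absurd ha hna
  rw [orthReflection_apply,
    Finset.sum_congr rfl (fun a ha => by rw [hneg a ha]), orthReflection_apply]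
  simp only [mul_neg, neg_smul, Finset.sum_neg_distrib]
  abel

end IsUnitRootSystem

/-- The unit circle of a plane, with basis `e₀`, `e₁`. -/
def circle (e₀ e₁ : V) (ψ : ℝ) : V := Real.cos ψ • e₀ + Real.sin ψ • e₁

/-- Two involutions `s`, `t` that permute the roots and act on a plane as the reflections in the
lines at the angles `0` and `φ`. If no root vanishes inside the sector between them, then `φ = π / n`,
and the roots can be counted by the line at an angle `k φ` on which they vanish. -/
theorem card_le_of_dihedral {s t : Module.End ℝ V} {e₀ e₁ : V} {φ : ℝ}
    (hφ : 0 < φ)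
    (hsΦ : ∀ β ∈ Φ, s β ∈ Φ) (htΦ : ∀ β ∈ Φ, t β ∈ Φ)
    (hs : ∀ x y, B (s x) y = B x (s y)) (ht : ∀ x y, B (t x) y = B x (t y))
    (hss : ∀ x, s (s x) = x) (htt : ∀ x, t (t x) = x)
    (hse : ∀ ψ, s (circle e₀ e₁ ψ) = circle e₀ e₁ (-ψ))
    (hte : ∀ ψ, t (circle e₀ e₁ ψ) = circle e₀ e₁ (2 * φ - ψ))
    (hne : ∀ β ∈ Φ, ∀ ψ, 0 < ψ → ψ < φ → B β (circle e₀ e₁ ψ) ≠ 0)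
    (hzero : ∃ β ∈ Φ, B β (circle e₀ e₁ 0) = 0) {p q : ℕ}
    (hp : (Φ.filter fun β => B β (circle e₀ e₁ 0) = 0).card ≤ 2 * p)
    (hq : (Φ.filter fun β => B β (circle e₀ e₁ φ) = 0).card ≤ 2 * q) :
    ∃ n : ℕ, 0 < n ∧ n * φ = Real.pi ∧ Φ.card ≤ (p + q) * n := by
  classical
  have hrot : ∀ β ψ, B β (circle e₀ e₁ (2 * φ + ψ)) = B (s (t β)) (circle e₀ e₁ ψ) := by
    intro β ψ
    rw [hs, ht, hse, hte]
    congr 2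
    ring
  have hne' : ∀ k : ℕ, ∀ β ∈ Φ, ∀ ψ, 0 < ψ → ψ < φ → B β (circle e₀ e₁ (k * φ + ψ)) ≠ 0 := by
    intro k
    induction k using Nat.twoStepInduction with
    | zero => simpa using hne
    | one =>
      intro β hβ ψ h0 h1
      have := hne (t β) (htΦ β hβ) (φ - ψ) (by linarith) (by linarith)
      rw [ht, hte] at this
      convert this using 3
      push_cast
      ring
    | more k ih _ =>
      intro β hβ ψ h0 h1
      have := ih (s (t β)) (hsΦ _ (htΦ β hβ)) ψ h0 h1
      rw [← hrot] at this
      convert this using 3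
      push_cast
      ring
  -- A zero at the angle `ψ ≥ 0` can only occur at a multiple of `φ`.
  have hmult : ∀ β ∈ Φ, ∀ ψ, 0 ≤ ψ → B β (circle e₀ e₁ ψ) = 0 → ∃ k : ℕ, k * φ = ψ := by
    intro β hβ ψ h0 h1
    refine ⟨⌊ψ / φ⌋₊, ?_⟩
    have hle := Nat.floor_le (div_nonneg h0 hφ.le)
    have hlt := Nat.lt_floor_add_one (ψ / φ)
    rw [le_div_iff₀ hφ] at hle
    rw [div_lt_iff₀ hφ] at hlt
    by_contra hne0
    have hlt' : (⌊ψ / φ⌋₊ : ℝ) * φ < ψ := lt_of_le_of_ne hle hne0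
    refine hne' ⌊ψ / φ⌋₊ β hβ (ψ - ⌊ψ / φ⌋₊ * φ) (by linarith) (by linarith) ?_
    rwa [add_sub_cancel]
  have hpi : ∀ β ψ, B β (circle e₀ e₁ (ψ + Real.pi)) = -B β (circle e₀ e₁ ψ) := by
    intro β ψ
    simp only [circle, Real.cos_add_pi, Real.sin_add_pi, map_add, map_smul, smul_eq_mul]
    ring
  obtain ⟨β₀, hβ₀, hz⟩ := hzero
  obtain ⟨n, hn⟩ := hmult β₀ hβ₀ Real.pi Real.pi_pos.le
    (by rw [← zero_add Real.pi, hpi, hz, neg_zero])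
  have hn0 : 0 < n := by
    rcases Nat.eq_zero_or_pos n with rfl | hpos
    · exact absurd hn (by simpa using Real.pi_pos.ne)
    · exact hpos
  refine ⟨n, hn0, hn, ?_⟩
  let Z : ℕ → Finset V := fun k => Φ.filter fun β => B β (circle e₀ e₁ (k * φ)) = 0
  have hZ : ∀ k, (Z (2 * k)).card ≤ 2 * p ∧ (Z (2 * k + 1)).card ≤ 2 * q := by
    have hstep : ∀ k, (Z (k + 2)).card ≤ (Z k).card := by
      intro k
      refine Finset.card_le_card_of_injOn (fun β => s (t β)) ?_ ?_
      · intro β hβ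
        obtain ⟨hβΦ, hβ0⟩ := Finset.mem_filter.1 (Finset.mem_coe.1 hβ)
        refine Finset.mem_coe.2 (Finset.mem_filter.2 ⟨hsΦ _ (htΦ _ hβΦ), ?_⟩)
        rw [← hrot, ← hβ0]
        congr 2
        push_cast
        ring
      · intro x _ y _ hxy
        have h1 := congrArg s hxy
        simp only [hss] at h1
        rw [← htt x, h1, htt]
    intro k
    induction k with
    | zero => exact ⟨by simpa [Z] using hp, by simpa [Z] using hq⟩
    | succ k ih => exact ⟨(hstep (2 * k)).trans ih.1, (hstep (2 * k + 1)).trans ih.2⟩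
  have hsum : ∀ m, ∑ k ∈ Finset.range (2 * m), (Z k).card ≤ 2 * ((p + q) * m) := by
    intro m
    induction m with
    | zero => simp
    | succ m ih =>
      rw [show 2 * (m + 1) = 2 * m + 1 + 1 by ring, Finset.sum_range_succ, Finset.sum_range_succ]
      have h1 := hZ m
      have h2 : 2 * ((p + q) * (m + 1)) = 2 * ((p + q) * m) + (2 * p + 2 * q) := by ring
      rw [h2]
      omega
  have htwo : ∀ β ∈ Φ,
      2 ≤ ((Finset.range (2 * n)).filter fun k : ℕ => B β (circle e₀ e₁ (k * φ)) = 0).card := by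
    intro β hβ
    have hcont : Continuous fun ψ => B β (circle e₀ e₁ ψ) := by
      simp only [circle, map_add, map_smul, smul_eq_mul]
      fun_prop
    obtain ⟨ψ, hψ0, hψπ, hψ⟩ : ∃ ψ, 0 ≤ ψ ∧ ψ < Real.pi ∧ B β (circle e₀ e₁ ψ) = 0 := by
      have hmem : (0 : ℝ) ∈ Set.uIcc (B β (circle e₀ e₁ 0)) (B β (circle e₀ e₁ Real.pi)) := by
        have h1 := hpi β 0
        rw [zero_add] at h1
        rw [h1, Set.mem_uIcc]
        rcases le_total (B β (circle e₀ e₁ 0)) 0 with h0 | h0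
        · left; constructor <;> linarith
        · right; constructor <;> linarith
      obtain ⟨ψ, hψ, hψ0⟩ := intermediate_value_uIcc hcont.continuousOn hmem
      rw [Set.uIcc_of_le Real.pi_pos.le] at hψ
      rcases eq_or_lt_of_le hψ.2 with rfl | hlt
      · refine ⟨0, le_rfl, Real.pi_pos, ?_⟩
        have h1 := hpi β 0
        rw [zero_add] at h1
        simp only at hψ0
        linarith
      · exact ⟨ψ, hψ.1, hlt, hψ0⟩
    obtain ⟨k, hk⟩ := hmult β hβ ψ hψ0 hψ
    have hkn : k < n := by
      rw [← hk, ← hn] at hψπ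
      exact_mod_cast lt_of_mul_lt_mul_right hψπ hφ.le
    have hsub : ({k, k + n} : Finset ℕ) ⊆
        (Finset.range (2 * n)).filter fun k : ℕ => B β (circle e₀ e₁ (k * φ)) = 0 := by
      intro j hj
      rw [Finset.mem_filter, Finset.mem_range]
      rcases Finset.mem_insert.1 hj with rfl | hj
      · exact ⟨by omega, by rw [hk, hψ]⟩
      · rw [Finset.mem_singleton] at hj
        subst hj
        refine ⟨by omega, ?_⟩
        rw [Nat.cast_add, add_mul, hk, hn, hpi, hψ, neg_zero]
    calc 2 = ({k, k + n} : Finset ℕ).card := (Finset.card_pair (by omega)).symm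
      _ ≤ _ := Finset.card_le_card hsub
  have hcount := Finset.sum_card_bipartiteAbove_eq_sum_card_bipartiteBelow
    (s := Φ) (t := Finset.range (2 * n)) (fun β (k : ℕ) => B β (circle e₀ e₁ (k * φ)) = 0)
  have hle : Φ.card * 2 ≤ ∑ k ∈ Finset.range (2 * n), (Z k).card := by
    have h1 := Finset.card_nsmul_le_sum Φ _ 2 htwo
    rw [smul_eq_mul] at h1
    exact h1.trans hcount.le
  have := hsum n
  omega

end CoxeterPlane

section CoxeterPlane

variable {V : Type*} [AddCommGroup V] [Module ℝ V] {B : LinearMap.BilinForm ℝ V} {Φ : Finset V}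
  {f : V →ₗ[ℝ] ℝ} {Δ : Finset V}

namespace IsSimpleSystem

theorem exists_coeff_or (hΔ : IsSimpleSystem B Φ f Δ) (h : IsUnitRootSystem B Φ)
    (hf : ∀ β ∈ Φ, f β ≠ 0) {β : V} (hβ : β ∈ Φ) :
    ∃ (c : V → ℝ) (γ : V), (∀ a, 0 ≤ c a) ∧ γ ∈ Φ ∧ γ = ∑ a ∈ Δ, c a • a ∧ (β = γ ∨ β = -γ) := by
  rcases lt_or_gt_of_ne (hf β hβ) with hneg | hpos
  · obtain ⟨c, hc, heq⟩ := hΔ.exists_coeff (-β) (h.neg_mem hβ) (by rw [map_neg]; linarith)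
    exact ⟨c, -β, hc, h.neg_mem hβ, heq, Or.inr (neg_neg β).symm⟩
  · obtain ⟨c, hc, heq⟩ := hΔ.exists_coeff β hβ hpos
    exact ⟨c, β, hc, hβ, heq, Or.inl rfl⟩

theorem span_eq_top (hΔ : IsSimpleSystem B Φ f Δ) (h : IsUnitRootSystem B Φ)
    (hf : ∀ β ∈ Φ, f β ≠ 0) (hspan : Submodule.span ℝ (Φ : Set V) = ⊤) :
    Submodule.span ℝ (Δ : Set V) = ⊤ := by
  rw [eq_top_iff, ← hspan, Submodule.span_le]
  intro β hβ
  obtain ⟨c, γ, -, -, hγ, hor⟩ := hΔ.exists_coeff_or h hf hβ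
  have hmem : γ ∈ Submodule.span ℝ (Δ : Set V) := by
    rw [hγ]
    exact Submodule.sum_mem _ fun a ha => Submodule.smul_mem _ _ (Submodule.subset_span ha)
  rcases hor with rfl | rfl
  · exact hmem
  · exact Submodule.neg_mem _ hmem

theorem linearIndependent (hΔ : IsSimpleSystem B Φ f Δ) :
    LinearIndependent ℝ (fun a : Δ => (a : V)) := by
  have : LinearIndepOn ℝ id (Δ : Set V) := linearIndepOn_finset_iff.2 hΔ.indep
  exact this

/-- The simple roots as a basis. -/
def basis (hΔ : IsSimpleSystem B Φ f Δ) (hspan : Submodule.span ℝ (Δ : Set V) = ⊤) :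
    Module.Basis Δ ℝ V :=
  Module.Basis.mk hΔ.linearIndependent (by
    rw [Subtype.range_coe_subtype, Finset.setOfPred_mem, hspan])

theorem basis_apply (hΔ : IsSimpleSystem B Φ f Δ) (hspan : Submodule.span ℝ (Δ : Set V) = ⊤)
    (a : Δ) : hΔ.basis hspan a = a := by
  simp [basis]

theorem card_eq_finrank (hΔ : IsSimpleSystem B Φ f Δ)
    (hspan : Submodule.span ℝ (Δ : Set V) = ⊤) : Δ.card = Module.finrank ℝ V := by
  rw [Module.finrank_eq_card_basis (hΔ.basis hspan), Fintype.card_coe]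

theorem ext_inner (hΔ : IsSimpleSystem B Φ f Δ)
    (hspan : Submodule.span ℝ (Δ : Set V) = ⊤) (h : IsUnitRootSystem B Φ) {x y : V}
    (hxy : ∀ a ∈ Δ, B x a = B y a) : x = y := by
  have heq : B x = B y := (hΔ.basis hspan).ext fun a => by
    rw [basis_apply]
    exact hxy a a.2
  by_contra hne
  have := h.pos (x - y) (sub_ne_zero.2 hne)
  have h0 : B (x - y) = 0 := by rw [map_sub, heq, sub_self]
  rw [h0, LinearMap.zero_apply] at this
  exact lt_irrefl _ this

theorem exists_inner_eq (hΔ : IsSimpleSystem B Φ f Δ)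
    (hspan : Submodule.span ℝ (Δ : Set V) = ⊤) (h : IsUnitRootSystem B Φ) (r : V → ℝ) :
    ∃ x, ∀ a ∈ Δ, B x a = r a := by
  have : FiniteDimensional ℝ V := (hΔ.basis hspan).finiteDimensional_of_finite
  have hinj : Function.Injective (B : V →ₗ[ℝ] Module.Dual ℝ V) := fun x y hxy =>
    hΔ.ext_inner hspan h fun a _ => by rw [hxy]
  have hsurj := (LinearMap.injective_iff_surjective_of_finrank_eq_finrank
    (Subspace.dual_finrank_eq (K := ℝ) (V := V)).symm).1 hinj
  obtain ⟨x, hx⟩ := hsurj ((hΔ.basis hspan).constr ℝ fun a => r a)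
  refine ⟨x, fun a ha => ?_⟩
  have := (hΔ.basis hspan).constr_basis ℝ (fun a => r a) ⟨a, ha⟩
  rw [basis_apply] at this
  rw [hx, this]

/-- The eigenvector of the Gram matrix of the simple roots with positive coefficients. -/
theorem exists_eigenvector (hΔ : IsSimpleSystem B Φ f Δ) (h : IsUnitRootSystem B Φ)
    (hf : ∀ β ∈ Φ, f β ≠ 0) (hne : Δ.Nonempty)
    (hirr : ∀ U : Submodule ℝ V, (∀ β ∈ Φ, β ∈ U ∨ ∀ u ∈ U, B u β = 0) → U = ⊥ ∨ U = ⊤) :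
    ∃ (θ : ℝ) (c : V → ℝ), 0 ≤ θ ∧ θ < 1 ∧ (∀ a ∈ Δ, 0 < c a) ∧
      ∀ a ∈ Δ, ∑ b ∈ Δ, c b * B b a = (1 - θ) * c a := by
  classical
  have : Nonempty Δ := hne.to_subtype
  let A : Matrix Δ Δ ℝ := fun a b => (if a = b then 1 else 0) - B a b
  have hAne : ∀ a b : Δ, a ≠ b → A a b = -B a b := fun a b hab => by simp [A, hab]
  obtain ⟨θ, c, hθ, hc, hA⟩ := exists_pos_eigenvector A
    (by
      ext a b
      change A b a = A a b
      simp [A, h.symm (b : V) a, eq_comm (a := b)])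
    (by
      intro a b
      by_cases hab : a = b
      · subst hab
        simp [A, h.unit _ (hΔ.subset a.2)]
      · rw [hAne a b hab, neg_nonneg]
        exact hΔ.obtuse a a.2 b b.2 fun e => hab (Subtype.ext e))
    (by
      -- The span of a connected component is an invariant subspace.
      intro Z hZne hZ
      have hZ' : ∀ a ∈ Δ, ∀ b ∈ Δ, a ∈ Subtype.val '' Z → b ∉ Subtype.val '' Z → B a b = 0 := by
        rintro _ - b hb ⟨a, ha, rfl⟩ hbZ
        have hbZ' : (⟨b, hb⟩ : Δ) ∉ Z := fun e => hbZ ⟨_, e, rfl⟩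
        have h0 := hZ a ha ⟨b, hb⟩ hbZ'
        rw [hAne a ⟨b, hb⟩ (fun e => hbZ' (by rwa [← e])), neg_eq_zero] at h0
        exact h0
      have horth : ∀ b ∈ Δ, b ∉ Subtype.val '' Z →
          ∀ u ∈ Submodule.span ℝ (Subtype.val '' Z), B u b = 0 := by
        intro b hb hbZ u hu
        induction hu using Submodule.span_induction with
        | mem x hx =>
          obtain ⟨a, -, rfl⟩ := id hx
          exact hZ' a a.2 b hb hx hbZ
        | zero => simp
        | add x y _ _ hx hy => rw [map_add, LinearMap.add_apply, hx, hy, add_zero]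
        | smul r x _ hx => rw [map_smul, LinearMap.smul_apply, hx, smul_zero]
      have hdich := hirr (Submodule.span ℝ (Subtype.val '' Z)) (by
        intro β hβ
        obtain ⟨d, γ, hd, hγ, rfl, hor⟩ := hΔ.exists_coeff_or h hf hβ
        rcases hΔ.coeff_eq_zero_of_orthogonal h hf hZ' (fun a _ => hd a) hγ with h0 | h0
        · right
          intro u hu
          have h1 : B u (∑ a ∈ Δ, d a • a) = 0 := by
            rw [map_sum]
            refine Finset.sum_eq_zero fun a ha => ?_
            by_cases haZ : a ∈ Subtype.val '' Z
            · rw [h0 a ha haZ, zero_smul, map_zero]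
            · rw [map_smul, horth a ha haZ u hu, smul_zero]
          rcases hor with rfl | rfl
          · exact h1
          · rw [map_neg, h1, neg_zero]
        · left
          have h1 : ∑ a ∈ Δ, d a • a ∈ Submodule.span ℝ (Subtype.val '' Z) := by
            refine Submodule.sum_mem _ fun a ha => ?_
            by_cases haZ : a ∈ Subtype.val '' Z
            · exact Submodule.smul_mem _ _ (Submodule.subset_span haZ)
            · rw [h0 a ha haZ, zero_smul]
              exact Submodule.zero_mem _
          rcases hor with rfl | rfl
          · exact h1
          · exact Submodule.neg_mem _ h1)
      rw [Set.eq_univ_iff_forall]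
      intro b
      by_contra hbZ
      have hbZ' : (b : V) ∉ Subtype.val '' Z := by
        rintro ⟨a, ha, hab⟩
        exact hbZ (Subtype.ext hab ▸ ha)
      rcases hdich with h0 | h0
      · obtain ⟨a, ha⟩ := hZne
        have h1 : (a : V) ∈ Submodule.span ℝ (Subtype.val '' Z) :=
          Submodule.subset_span ⟨a, ha, rfl⟩
        rw [h0, Submodule.mem_bot] at h1
        exact h.ne_zero (hΔ.subset a.2) h1
      · have h1 := horth b b.2 hbZ' b (h0 ▸ Submodule.mem_top)
        rw [h.unit _ (hΔ.subset b.2)] at h1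
        exact one_ne_zero h1)
  let c' : V → ℝ := fun a => if ha : a ∈ Δ then c ⟨a, ha⟩ else 0
  have hc' : ∀ a : Δ, c' a = c a := fun a => by simp [c']
  have hpos : ∀ a ∈ Δ, 0 < c' a := fun a ha => by
    rw [hc' ⟨a, ha⟩]
    exact hc _
  have heig : ∀ a ∈ Δ, ∑ b ∈ Δ, c' b * B b a = (1 - θ) * c' a := by
    intro a ha
    have h1 := congrFun hA ⟨a, ha⟩
    simp only [Matrix.mulVec, dotProduct, Pi.smul_apply, smul_eq_mul, A, sub_mul, ite_mul, one_mul,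
      zero_mul, Finset.sum_sub_distrib, Finset.sum_ite_eq, Finset.mem_univ, if_true] at h1
    rw [← Finset.sum_coe_sort Δ, hc' ⟨a, ha⟩]
    have h2 : ∑ b : Δ, c' b * B b a = ∑ b : Δ, B a b * c b :=
      Finset.sum_congr rfl fun b _ => by rw [hc', h.symm a b, mul_comm]
    rw [h2]
    linarith
  refine ⟨θ, c', hθ, ?_, hpos, heig⟩
  have hy : ∑ a ∈ Δ, c' a • a ≠ 0 := by
    intro h0
    obtain ⟨a, ha⟩ := hne
    exact (hpos a ha).ne' (hΔ.indep c' h0 a ha)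
  have h1 := h.pos _ hy
  simp only [map_sum, LinearMap.sum_apply, map_smul, LinearMap.smul_apply, smul_eq_mul] at h1
  have h2 : ∑ a ∈ Δ, c' a * ∑ b ∈ Δ, c' b * B b a = (1 - θ) * ∑ a ∈ Δ, c' a * c' a := by
    rw [Finset.mul_sum]
    exact Finset.sum_congr rfl fun a ha => by rw [heig a ha]; ring
  rw [h2] at h1
  have h3 : 0 ≤ ∑ a ∈ Δ, c' a * c' a := Finset.sum_nonneg fun a _ => mul_self_nonneg _
  by_contra hcon
  have := mul_nonpos_of_nonpos_of_nonneg (a := 1 - θ) (by linarith) h3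
  linarith

/-- The roots orthogonal to a point of the face of the chamber on which the simple roots in `J`
vanish are the simple roots in `J` and their negatives, if those are pairwise orthogonal. -/
theorem card_filter_le (hΔ : IsSimpleSystem B Φ f Δ) (h : IsUnitRootSystem B Φ)
    (hf : ∀ β ∈ Φ, f β ≠ 0) {J : Finset V}
    (horth : ∀ a ∈ J, ∀ b ∈ J, a ≠ b → B a b = 0) {x : V}
    (hx0 : ∀ a ∈ Δ, 0 ≤ B x a) (hx : ∀ a ∈ Δ, a ∉ J → 0 < B x a) :
    (Φ.filter fun β => B β x = 0).card ≤ 2 * J.card := by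
  classical
  have hsub : (Φ.filter fun β => B β x = 0) ⊆ J ∪ J.image fun a => -a := by
    intro β hβ
    obtain ⟨hβΦ, hβ0⟩ := Finset.mem_filter.1 hβ
    obtain ⟨c, γ, hc, hγ, rfl, hor⟩ := hΔ.exists_coeff_or h hf hβΦ
    have h0 : B (∑ a ∈ Δ, c a • a) x = 0 := by
      rcases hor with rfl | rfl
      · exact hβ0
      · rwa [map_neg, LinearMap.neg_apply, neg_eq_zero] at hβ0
    rw [h.symm] at h0
    simp only [map_sum, map_smul, smul_eq_mul] at h0
    have h1 := (Finset.sum_eq_zero_iff_of_nonneg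
      (fun a ha => mul_nonneg (hc a) (hx0 a ha))).1 h0
    have hmem := hΔ.mem_of_orthogonal h hf horth (fun a _ => hc a) hγ
      (fun a ha haJ => (mul_eq_zero.1 (h1 a ha)).resolve_right (hx a ha haJ).ne')
    rcases hor with rfl | rfl
    · exact Finset.mem_union_left _ hmem
    · exact Finset.mem_union_right _ (Finset.mem_image_of_mem _ hmem)
  calc _ ≤ _ := Finset.card_le_card hsub
    _ ≤ J.card + (J.image fun a => -a).card := Finset.card_union_le _ _
    _ ≤ J.card + J.card := Nat.add_le_add_left Finset.card_image_le _
    _ = 2 * J.card := by ring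

/-- The product of the reflections in the simple roots in `J` acts on the plane of `x` and `y` as
the reflection in the line of `x`. -/
theorem orthReflection_apply_of_eigenvector (hΔ : IsSimpleSystem B Φ f Δ)
    (hspan : Submodule.span ℝ (Δ : Set V) = ⊤) (h : IsUnitRootSystem B Φ)
    {J : Finset V} (horth : ∀ a ∈ J, ∀ b ∈ J, a ≠ b → B a b = 0) {θ : ℝ} {c : V → ℝ}
    (heig : ∀ a ∈ Δ, a ∉ J → ∑ b ∈ J, c b * B b a = -θ * c a) {x y : V}
    (hxJ : ∀ a ∈ J, B x a = 0) (hx : ∀ a ∈ Δ, a ∉ J → B x a = c a)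
    (hyJ : ∀ a ∈ J, B y a = c a) (hy : ∀ a ∈ Δ, a ∉ J → B y a = 0) :
    orthReflection B J x = x ∧ orthReflection B J y = -y + (2 * θ) • x := by
  constructor
  · rw [orthReflection_apply, Finset.sum_eq_zero, sub_zero]
    intro a ha
    rw [hxJ a ha, mul_zero, zero_smul]
  · refine hΔ.ext_inner hspan h fun a ha => ?_
    rw [orthReflection_apply]
    simp only [map_sub, map_add, map_neg, map_sum, map_smul, LinearMap.sub_apply,
      LinearMap.add_apply, LinearMap.neg_apply, LinearMap.sum_apply, LinearMap.smul_apply,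
      smul_eq_mul]
    have hsum : ∑ b ∈ J, 2 * B y b * B b a = 2 * ∑ b ∈ J, c b * B b a := by
      rw [Finset.mul_sum]
      exact Finset.sum_congr rfl fun b hb => by rw [hyJ b hb]; ring
    rw [hsum]
    by_cases haJ : a ∈ J
    · rw [Finset.sum_eq_single a, h.unit a (hΔ.subset ha), hyJ a haJ, hxJ a haJ]
      · ring
      · intro b hb hba
        rw [horth b hb a haJ hba, mul_zero]
      · exact fun hna => absurd haJ hna
    · rw [heig a ha haJ, hx a ha haJ, hy a ha haJ]
      ring

end IsSimpleSystem

/-- Existence of the Coxeter plane: an element `g` of the reflection group rotates the plane of `e₀`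
and `e₁` by `2π / n`, no root vanishes on this plane, and there are at most `n · dim V` roots. (In
dimension one `g = -1`, `n = 2` and `e₁ = 0`.) -/
theorem IsUnitRootSystem.exists_coxeter_plane (h : IsUnitRootSystem B Φ) [Nontrivial V]
    (hspan : Submodule.span ℝ (Φ : Set V) = ⊤)
    (hirr : ∀ U : Submodule ℝ V, (∀ β ∈ Φ, β ∈ U ∨ ∀ u ∈ U, B u β = 0) → U = ⊥ ∨ U = ⊤) :
    ∃ g ∈ Submonoid.closure (rootReflection B '' (Φ : Set V)), ∃ (n : ℕ) (e₀ e₁ : V), 0 < n ∧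
      g e₀ = circle e₀ e₁ (2 * Real.pi / n) ∧
      g e₁ = circle e₀ e₁ (2 * Real.pi / n + Real.pi / 2) ∧
      (∀ β ∈ Φ, B β e₀ ≠ 0 ∨ B β e₁ ≠ 0) ∧ Φ.card ≤ Module.finrank ℝ V * n := by
  classical
  obtain ⟨f, Δ, hf, hΔ⟩ := h.exists_isSimpleSystem
  have hspanΔ := hΔ.span_eq_top h hf hspan
  have hne : Δ.Nonempty := by
    rw [Finset.nonempty_iff_ne_empty]
    rintro rfl
    rw [Finset.coe_empty, Submodule.span_empty] at hspanΔ
    exact bot_ne_top hspanΔ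
  obtain ⟨col, hcol⟩ := hΔ.exists_coloring h hf subset_rfl
  obtain ⟨θ, c, hθ0, hθ1, hc, heig⟩ := hΔ.exists_eigenvector h hf hne hirr
  -- `x true` and `x false` span the plane, `x k` vanishes on the simple roots of the other colour.
  let J : Bool → Finset V := fun k => Δ.filter fun a => col a = !k
  have hJ : ∀ k, J k ⊆ Δ := fun k => Finset.filter_subset _ _
  have hJΦ : ∀ k, J k ⊆ Φ := fun k => (hJ k).trans hΔ.subset
  have horth : ∀ k, ∀ a ∈ J k, ∀ b ∈ J k, a ≠ b → B a b = 0 := by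
    intro k a ha b hb hab
    by_contra h0
    obtain ⟨ha, ha'⟩ := Finset.mem_filter.1 ha
    obtain ⟨hb, hb'⟩ := Finset.mem_filter.1 hb
    exact hcol a ha b hb hab h0 (ha'.trans hb'.symm)
  have hcard : (J true).card + (J false).card = Module.finrank ℝ V := by
    rw [← hΔ.card_eq_finrank hspanΔ,
      ← Finset.card_filter_add_card_filter_not (s := Δ) (fun a => col a = true), add_comm]
    simp [J]
  have hex : ∀ k, ∃ x, ∀ a ∈ Δ, B x a = if a ∈ J k then 0 else c a := fun k =>
    hΔ.exists_inner_eq hspanΔ h _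
  choose x hx using hex
  have hxJ : ∀ k, ∀ a ∈ J k, B (x k) a = 0 := fun k a ha => by rw [hx k a (hJ k ha), if_pos ha]
  have hxn : ∀ k, ∀ a ∈ Δ, a ∉ J k → B (x k) a = c a := fun k a ha ha' => by
    rw [hx k a ha, if_neg ha']
  have hJn : ∀ k, ∀ a ∈ Δ, a ∉ J k ↔ a ∈ J (!k) := by
    intro k a ha
    simp only [J, Finset.mem_filter, ha, true_and]
    cases k <;> simp
  have hx0 : ∀ k, ∀ a ∈ Δ, 0 ≤ B (x k) a := fun k a ha => by
    rw [hx k a ha]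
    split_ifs
    · exact le_rfl
    · exact (hc a ha).le
  have heig' : ∀ k, ∀ a ∈ Δ, a ∉ J k → ∑ b ∈ J k, c b * B b a = -θ * c a := by
    intro k a ha ha'
    have h1 := heig a ha
    have h2 : ∑ b ∈ Δ, c b * B b a = ∑ b ∈ J k, c b * B b a + c a := by
      rw [← Finset.sum_filter_add_sum_filter_not Δ (fun b => col b = !k)]
      congr 1
      rw [Finset.sum_eq_single a]
      · rw [h.unit a (hΔ.subset ha), mul_one]
      · intro b hb hba
        obtain ⟨hb, hb'⟩ := Finset.mem_filter.1 hb
        have hbJ : b ∈ J (!k) := (hJn k b hb).1 fun e => hb' (Finset.mem_filter.1 e).2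
        rw [horth (!k) b hbJ a ((hJn k a ha).1 ha') hba, mul_zero]
      · intro hna
        exact absurd (Finset.mem_filter.2 ⟨ha, fun e => ha' (Finset.mem_filter.2 ⟨ha, e⟩)⟩) hna
    linarith
  have hrefl : ∀ k, orthReflection B (J k) (x k) = x k ∧
      orthReflection B (J k) (x !k) = -(x !k) + (2 * θ) • x k := fun k =>
    hΔ.orthReflection_apply_of_eigenvector hspanΔ h (horth k) (heig' k) (hxJ k) (hxn k)
      (fun a ha => by
        rw [hxn (!k) a (hJ k ha)]
        rw [hJn (!k) a (hJ k ha), Bool.not_not]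
        exact ha)
      (fun a ha ha' => hxJ (!k) a ((hJn k a ha).1 ha'))
  have hcl : ∀ k, orthReflection B (J k) ∈
      Submonoid.closure (rootReflection B '' (Φ : Set V)) := fun k =>
    orthReflection_mem_closure (hJΦ k) (horth k)
  have hcard_le : ∀ k, (Φ.filter fun β => B β (x k) = 0).card ≤ 2 * (J k).card := fun k =>
    hΔ.card_filter_le h hf (horth k) (hx0 k) fun a ha ha' => by
      rw [hxn k a ha ha']
      exact hc a ha
  by_cases hempty : ∃ k, J k = ∅
  · -- All simple roots are orthogonal; the product of their reflections is `-1`.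
    obtain ⟨k, hk⟩ := hempty
    have hfilter := hcard_le k
    rw [hk, Finset.card_empty, mul_zero, Nat.le_zero, Finset.card_eq_zero,
      Finset.filter_eq_empty_iff] at hfilter
    have hall : ∀ a ∈ Δ, a ∈ J (!k) := fun a ha => (hJn k a ha).1 (by rw [hk]; simp)
    refine ⟨_, hcl (!k), 2, x k, 0, two_pos, ?_, ?_, fun β hβ => Or.inl (hfilter hβ), ?_⟩
    · have hz : x (!k) = 0 := hΔ.ext_inner hspanΔ h fun a ha => by
        rw [hxJ _ a (hall a ha)]; simp
      have := (hrefl (!k)).2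
      rw [Bool.not_not, hz, smul_zero, add_zero] at this
      rw [this]
      simp [circle]
    · simp [circle, Real.cos_add]
    · have hz : x (!k) = 0 := hΔ.ext_inner hspanΔ h fun a ha => by
        rw [hxJ _ a (hall a ha)]; simp
      have h1 := hcard_le (!k)
      rw [hz] at h1
      simp only [map_zero, Finset.filter_true] at h1
      have h2 : (J (!k)).card ≤ Module.finrank ℝ V := by
        rw [← hΔ.card_eq_finrank hspanΔ]
        exact Finset.card_le_card (hJ _)
      omega
  push Not at hempty
  set φ := Real.arccos θ with hφ
  have hcos : Real.cos φ = θ := Real.cos_arccos (by linarith) hθ1.le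
  have hφ0 : 0 < φ := Real.arccos_pos.2 hθ1
  have hφ2 : φ ≤ Real.pi / 2 := Real.arccos_le_pi_div_two.2 hθ0
  have hsin : 0 < Real.sin φ := Real.sin_pos_of_pos_of_lt_pi hφ0 (by linarith [Real.pi_pos])
  set e₀ := x true with he₀
  set e₁ := (Real.sin φ)⁻¹ • (x false - θ • x true) with he₁
  set s := orthReflection B (J true) with hs
  set t := orthReflection B (J false) with ht
  have hcirc : ∀ ψ, circle e₀ e₁ ψ =
      (Real.sin φ)⁻¹ • (Real.sin (φ - ψ) • x true + Real.sin ψ • x false) := by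
    intro ψ
    simp only [circle, he₀, he₁, Real.sin_sub, hcos]
    match_scalars <;> field_simp
    ring
  have hs₀ : s (x true) = x true := (hrefl true).1
  have hs₁ : s (x false) = -(x false) + (2 * θ) • x true := (hrefl true).2
  have ht₀ : t (x false) = x false := (hrefl false).1
  have ht₁ : t (x true) = -(x true) + (2 * θ) • x false := (hrefl false).2
  have hse : ∀ ψ, s (circle e₀ e₁ ψ) = circle e₀ e₁ (-ψ) := by
    intro ψ
    rw [hcirc, hcirc]
    simp only [map_smul, map_add, hs₀, hs₁, Real.sin_neg, sub_neg_eq_add]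
    have h1 : Real.sin (φ + ψ) = Real.sin (φ - ψ) + 2 * θ * Real.sin ψ := by
      rw [Real.sin_add, Real.sin_sub, hcos]; ring
    rw [h1]
    module
  have hte : ∀ ψ, t (circle e₀ e₁ ψ) = circle e₀ e₁ (2 * φ - ψ) := by
    intro ψ
    rw [hcirc, hcirc]
    simp only [map_smul, map_add, ht₀, ht₁]
    have h1 : Real.sin (φ - (2 * φ - ψ)) = -Real.sin (φ - ψ) := by
      rw [← Real.sin_neg]; congr 1; ring
    have h2 : Real.sin (2 * φ - ψ) = Real.sin ψ + 2 * θ * Real.sin (φ - ψ) := by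
      rw [Real.sin_sub, Real.sin_sub, Real.sin_two_mul, Real.cos_two_mul, hcos]; ring
    rw [h1, h2]
    module
  have hne : ∀ β ∈ Φ, ∀ ψ, 0 < ψ → ψ < φ → B β (circle e₀ e₁ ψ) ≠ 0 := by
    intro β hβ ψ h0 h1
    -- The point lies in the open chamber.
    have hdom : ∀ a ∈ Δ, 0 < B (circle e₀ e₁ ψ) a := by
      intro a ha
      have hs1 : 0 < Real.sin (φ - ψ) :=
        Real.sin_pos_of_pos_of_lt_pi (by linarith) (by linarith [Real.pi_pos])
      have hs2 : 0 < Real.sin ψ :=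
        Real.sin_pos_of_pos_of_lt_pi h0 (by linarith [Real.pi_pos])
      rw [hcirc]
      simp only [map_smul, map_add, LinearMap.smul_apply, LinearMap.add_apply, smul_eq_mul]
      refine mul_pos (inv_pos.2 hsin) ?_
      by_cases haJ : a ∈ J true
      · have h2 := hxn false a ha ((hJn false a ha).2 haJ)
        rw [hxJ true a haJ, h2]
        have := mul_pos hs2 (hc a ha)
        linarith
      · have h2 := hxJ false a ((hJn true a ha).1 haJ)
        rw [hxn true a ha haJ, h2]
        have := mul_pos hs1 (hc a ha)
        linarith
    intro hzero
    have hfilter := hΔ.card_filter_le h hf (J := ∅) (by simp) (fun a ha => (hdom a ha).le)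
      (fun a ha _ => hdom a ha)
    rw [Finset.card_empty, mul_zero, Nat.le_zero, Finset.card_eq_zero,
      Finset.filter_eq_empty_iff] at hfilter
    exact hfilter hβ hzero
  have hc0 : circle e₀ e₁ 0 = x true := by simp [circle, he₀]
  have hcφ : circle e₀ e₁ φ = x false := by
    rw [hcirc, sub_self, Real.sin_zero, zero_smul, zero_add, inv_smul_smul₀ hsin.ne']
  obtain ⟨a, ha⟩ := hempty true
  obtain ⟨n, hn0, hnφ, hcardΦ⟩ := card_le_of_dihedral hφ0
    (h.mem_of_mem_closure (hcl true)) (h.mem_of_mem_closure (hcl false))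
    (h.orthReflection_symm (J true)) (h.orthReflection_symm (J false))
    (h.orthReflection_orthReflection (hJΦ true) (horth true))
    (h.orthReflection_orthReflection (hJΦ false) (horth false))
    hse hte hne ⟨a, hJΦ true ha, by rw [hc0, h.symm, hxJ true a ha]⟩
    (by rw [hc0]; exact hcard_le true) (by rw [hcφ]; exact hcard_le false)
  have hang : 2 * Real.pi / n = 2 * φ := by
    rw [← hnφ]
    have : (n : ℝ) ≠ 0 := by exact_mod_cast hn0.ne'
    field_simp
  have hrot : ∀ ψ, (t * s) (circle e₀ e₁ ψ) = circle e₀ e₁ (2 * φ + ψ) := by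
    intro ψ
    rw [Module.End.mul_apply, hse, hte, sub_neg_eq_add]
  refine ⟨t * s, mul_mem (hcl false) (hcl true), n, e₀, e₁, hn0, ?_, ?_, ?_, ?_⟩
  · have := hrot 0
    rw [add_zero] at this
    rw [hang, ← this]
    simp [circle]
  · rw [hang, ← hrot]
    simp [circle]
  · intro β hβ
    by_contra! h0
    refine hne β hβ (φ / 2) (by linarith) (by linarith) ?_
    simp [circle, h0.1, h0.2]
  · rw [← hcard]
    exact hcardΦ

end CoxeterPlane

/-! ### The roots of a reflection group -/

section GroupRoots

open Matrix

variable {ℓ : ℕ} {W : Subgroup (GL (Fin ℓ) ℝ)} {G : Matrix (Fin ℓ) (Fin ℓ) ℝ}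

/-- `β` is a unit root of `W`: the orthogonal reflection with root `β` belongs to `W`. -/
def IsRoot (W : Subgroup (GL (Fin ℓ) ℝ)) (G : Matrix (Fin ℓ) (Fin ℓ) ℝ) (β : Fin ℓ → ℝ) : Prop :=
  toBilin' G β β = 1 ∧
    ∃ w ∈ W, ∀ x, (w : Matrix (Fin ℓ) (Fin ℓ) ℝ) *ᵥ x = rootReflection (toBilin' G) β x

theorem mulVec_injective_GL (w : GL (Fin ℓ) ℝ) :
    Function.Injective fun x : Fin ℓ → ℝ => (w : Matrix (Fin ℓ) (Fin ℓ) ℝ) *ᵥ x :=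
  mulVec_injective_of_isUnit w.isUnit

theorem inv_mulVec_mulVec (w : GL (Fin ℓ) ℝ) (x : Fin ℓ → ℝ) :
    ((w⁻¹ : GL (Fin ℓ) ℝ) : Matrix (Fin ℓ) (Fin ℓ) ℝ) *ᵥ
      ((w : Matrix (Fin ℓ) (Fin ℓ) ℝ) *ᵥ x) = x := by
  rw [mulVec_mulVec, ← GeneralLinearGroup.coe_mul, inv_mul_cancel, GeneralLinearGroup.coe_one,
    one_mulVec]

theorem GL_ext_mulVec {w w' : GL (Fin ℓ) ℝ}
    (h : ∀ x, (w : Matrix (Fin ℓ) (Fin ℓ) ℝ) *ᵥ x = (w' : Matrix (Fin ℓ) (Fin ℓ) ℝ) *ᵥ x) :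
    w = w' :=
  Units.ext (ext_of_mulVec_single fun _ => h _)

theorem finite_setOf_isRoot (G : Matrix (Fin ℓ) (Fin ℓ) ℝ) (hW : Finite W) :
    {β | IsRoot W G β}.Finite := by
  have hsub : {β | IsRoot W G β} ⊆ ⋃ w : W, {β | toBilin' G β β = 1 ∧
      ∀ x, ((w : GL (Fin ℓ) ℝ) : Matrix (Fin ℓ) (Fin ℓ) ℝ) *ᵥ x =
        rootReflection (toBilin' G) β x} := by
    rintro β ⟨h1, w, hw, hβ⟩
    exact Set.mem_iUnion.2 ⟨⟨w, hw⟩, h1, hβ⟩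
  refine (Set.finite_iUnion fun w => ?_).subset hsub
  rcases Set.eq_empty_or_nonempty {β | toBilin' G β β = 1 ∧
      ∀ x, ((w : GL (Fin ℓ) ℝ) : Matrix (Fin ℓ) (Fin ℓ) ℝ) *ᵥ x =
        rootReflection (toBilin' G) β x} with he | ⟨γ, hγ1, hγ⟩
  · rw [he]
    exact Set.finite_empty
  -- The reflection determines its unit root up to sign.
  refine (Set.toFinite {γ, -γ}).subset ?_
  rintro β ⟨hβ1, hβ⟩
  have h1 : rootReflection (toBilin' G) γ β = -β := by
    rw [← hγ, hβ, rootReflection_apply, hβ1]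
    module
  rw [rootReflection_apply] at h1
  set k := toBilin' G β γ
  have h2 : β = k • γ := by
    have : (2 : ℝ) • β = (2 : ℝ) • (k • γ) := by
      rw [two_smul, smul_smul]
      nth_rewrite 2 [← neg_neg β]
      rw [← h1]
      abel
    exact smul_right_injective _ (two_ne_zero) this
  have h3 : k * k = 1 := by
    rw [h2, map_smul, map_smul, LinearMap.smul_apply, hγ1] at hβ1
    simpa using hβ1
  rcases mul_self_eq_one_iff.1 h3 with h4 | h4
  · left
    rw [h2, h4, one_smul]
  · right
    rw [Set.mem_singleton_iff, h2, h4, neg_smul, one_smul]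

/-- The finite set of unit roots of `W`. -/
def roots (G : Matrix (Fin ℓ) (Fin ℓ) ℝ) (hW : Finite W) : Finset (Fin ℓ → ℝ) :=
  (finite_setOf_isRoot G hW).toFinset

theorem mem_roots (hW : Finite W) {β : Fin ℓ → ℝ} :
    β ∈ roots G hW ↔ IsRoot W G β := by
  simp [roots]

namespace IsInvariantInnerProduct

theorem symm (hG : IsInvariantInnerProduct W G) (x y : Fin ℓ → ℝ) :
    toBilin' G x y = toBilin' G y x := by
  have hT : Gᵀ = G := by simpa [IsHermitian, conjTranspose_eq_transpose_of_trivial] using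
    hG.posDef.isHermitian
  rw [toBilin'_apply', toBilin'_apply', dotProduct_comm, ← vecMul_transpose, hT,
    dotProduct_mulVec]

theorem pos (hG : IsInvariantInnerProduct W G) (x : Fin ℓ → ℝ) (hx : x ≠ 0) :
    0 < toBilin' G x x := by
  have := hG.posDef.dotProduct_mulVec_pos hx
  rwa [star_trivial, ← toBilin'_apply'] at this

theorem mulVec_mulVec (hG : IsInvariantInnerProduct W G) {w : GL (Fin ℓ) ℝ} (hw : w ∈ W)
    (x y : Fin ℓ → ℝ) :
    toBilin' G ((w : Matrix (Fin ℓ) (Fin ℓ) ℝ) *ᵥ x) ((w : Matrix (Fin ℓ) (Fin ℓ) ℝ) *ᵥ y) =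
      toBilin' G x y := by
  rw [toBilin'_apply', toBilin'_apply', ← vecMul_transpose, ← dotProduct_mulVec,
    Matrix.mulVec_mulVec, Matrix.mulVec_mulVec, hG.invariant w hw]

/-- An isometry `w ≠ 1` with `(1 - w) x` always on one line is the reflection whose root spans this
line. -/
theorem exists_isRoot (hG : IsInvariantInnerProduct W G) {w : GL (Fin ℓ) ℝ} (hw : w ∈ W)
    (hw1 : w ≠ 1) {z : Fin ℓ → ℝ} (hz : z ≠ 0)
    (h : ∀ x, ∃ c : ℝ, x - (w : Matrix (Fin ℓ) (Fin ℓ) ℝ) *ᵥ x = c • z) :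
    ∃ β, IsRoot W G β ∧ (∃ r : ℝ, r ≠ 0 ∧ z = r • β) ∧
      ∀ x, (w : Matrix (Fin ℓ) (Fin ℓ) ℝ) *ᵥ x = rootReflection (toBilin' G) β x := by
  set B := toBilin' G with hB
  set r := Real.sqrt (B z z)
  have hr : r ≠ 0 := (Real.sqrt_pos.2 (hG.pos z hz)).ne'
  have hrr : r * r = B z z := Real.mul_self_sqrt (hG.pos z hz).le
  set β := r⁻¹ • z with hβ
  have hzβ : z = r • β := by rw [hβ, smul_inv_smul₀ hr]
  have hβ1 : B β β = 1 := by
    rw [hβ, map_smul, map_smul, LinearMap.smul_apply, ← hrr]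
    simp only [smul_eq_mul]
    field_simp
  have hc : ∀ x, ∃ c : ℝ, (w : Matrix (Fin ℓ) (Fin ℓ) ℝ) *ᵥ x = x - c • β := by
    intro x
    obtain ⟨c, hc⟩ := h x
    refine ⟨c * r, ?_⟩
    rw [mul_smul, ← hzβ, ← hc]
    abel
  have hnorm : ∀ x (c : ℝ), (w : Matrix (Fin ℓ) (Fin ℓ) ℝ) *ᵥ x = x - c • β →
      c * (c - 2 * B x β) = 0 := by
    intro x c hx
    have h1 := hG.mulVec_mulVec hw x x
    rw [hx, ← hB] at h1
    simp only [map_sub, map_smul, LinearMap.sub_apply, LinearMap.smul_apply, smul_eq_mul,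
      hβ1] at h1
    rw [hG.symm β x, ← hB] at h1
    linarith
  have hfix : ∀ x, B x β = 0 → (w : Matrix (Fin ℓ) (Fin ℓ) ℝ) *ᵥ x = x := by
    intro x hx
    obtain ⟨c, hc⟩ := hc x
    have h1 := hnorm x c hc
    rw [hx, mul_zero, sub_zero, mul_self_eq_zero] at h1
    rw [hc, h1, zero_smul, sub_zero]
  obtain ⟨c, hcβ⟩ := hc β
  have hall : ∀ x, (w : Matrix (Fin ℓ) (Fin ℓ) ℝ) *ᵥ x = x - (c * B x β) • β := by
    intro x
    have h1 := hfix (x - B x β • β) (by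
      rw [map_sub, LinearMap.sub_apply, map_smul B, LinearMap.smul_apply, hβ1, smul_eq_mul]
      ring)
    rw [mulVec_sub, mulVec_smul, hcβ, sub_eq_iff_eq_add] at h1
    rw [h1]
    module
  have hc2 : c = 2 := by
    have h1 := hnorm β c hcβ
    rw [hβ1] at h1
    rcases mul_eq_zero.1 h1 with h0 | h0
    · refine absurd (GL_ext_mulVec fun x => ?_) hw1
      rw [hall, h0, GeneralLinearGroup.coe_one, one_mulVec]
      simp
    · linarith
  have hrefl : ∀ x, (w : Matrix (Fin ℓ) (Fin ℓ) ℝ) *ᵥ x = rootReflection B β x := fun x => by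
    rw [hall, rootReflection_apply, hc2]
  exact ⟨β, ⟨hβ1, w, hw, hrefl⟩, ⟨r, hr, hzβ⟩, hrefl⟩

theorem exists_isRoot_of_isReflection (hG : IsInvariantInnerProduct W G) {w : GL (Fin ℓ) ℝ}
    (hw : w ∈ W) (h : IsReflection w) : ∃ β, IsRoot W G β ∧
      ∀ x, (w : Matrix (Fin ℓ) (Fin ℓ) ℝ) *ᵥ x = rootReflection (toBilin' G) β x := by
  have hrank := h.2
  rw [Matrix.rank, finrank_eq_one_iff'] at hrank
  obtain ⟨z, hz, hspan⟩ := hrank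
  have hw1 : w ≠ 1 := by
    rintro rfl
    have := h.2
    simp at this
  obtain ⟨β, hβ, -, hrefl⟩ := hG.exists_isRoot hw hw1 (z := z) (by simpa using hz) (fun x => by
    obtain ⟨c, hc⟩ := hspan ⟨_, LinearMap.mem_range_self _ x⟩
    refine ⟨-c, ?_⟩
    have := congrArg Subtype.val hc
    simp only [SetLike.val_smul, mulVecLin_apply, sub_mulVec, one_mulVec] at this
    rw [neg_smul, this, neg_sub])
  exact ⟨β, hβ, hrefl⟩

theorem isUnitRootSystem (hG : IsInvariantInnerProduct W G) (hW : Finite W) :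
    IsUnitRootSystem (toBilin' G) (roots G hW) where
  symm := hG.symm
  pos := hG.pos
  unit a ha := ((mem_roots hW).1 ha).1
  reflection_mem a ha b hb := by
    rw [mem_roots] at *
    obtain ⟨ha1, s, hs, hsa⟩ := ha
    obtain ⟨hb1, t, ht, htb⟩ := hb
    rw [← hsa]
    refine ⟨by rw [hG.mulVec_mulVec hs, hb1], s * t * s⁻¹, mul_mem (mul_mem hs ht) (inv_mem hs),
      fun x => ?_⟩
    obtain ⟨y, rfl⟩ : ∃ y, (s : Matrix (Fin ℓ) (Fin ℓ) ℝ) *ᵥ y = x :=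
      ⟨_, by have := inv_mulVec_mulVec s⁻¹ x; rwa [inv_inv] at this⟩
    rw [rootReflection_apply, hG.mulVec_mulVec hs, GeneralLinearGroup.coe_mul,
      GeneralLinearGroup.coe_mul, ← Matrix.mulVec_mulVec, inv_mulVec_mulVec,
      ← Matrix.mulVec_mulVec, htb, rootReflection_apply, mulVec_sub, mulVec_smul]

/-- A subspace that contains or is orthogonal to each root is invariant. -/
theorem eq_bot_or_eq_top (hG : IsInvariantInnerProduct W G) (hW : IsReflectionGroup W)
    (hirr : IsIrreducible W) (U : Submodule ℝ (Fin ℓ → ℝ))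
    (hU : ∀ β, IsRoot W G β → β ∈ U ∨ ∀ u ∈ U, toBilin' G u β = 0) : U = ⊥ ∨ U = ⊤ := by
  refine hirr.eq_bot_or_eq_top U fun w hw => ?_
  have hw' := hw
  rw [← hW.closure_eq] at hw'
  suffices h : (∀ v ∈ U, (w : Matrix (Fin ℓ) (Fin ℓ) ℝ) *ᵥ v ∈ U) ∧
      ∀ v ∈ U, ((w⁻¹ : GL (Fin ℓ) ℝ) : Matrix (Fin ℓ) (Fin ℓ) ℝ) *ᵥ v ∈ U from h.1
  clear hw
  induction hw' using Subgroup.closure_induction with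
  | mem g hg =>
    obtain ⟨β, hβ, hrefl⟩ := hG.exists_isRoot_of_isReflection hg.1 hg.2
    have h1 : ∀ v ∈ U, (g : Matrix (Fin ℓ) (Fin ℓ) ℝ) *ᵥ v ∈ U := by
      intro v hv
      rw [hrefl, rootReflection_apply]
      rcases hU β hβ with h0 | h0
      · exact U.sub_mem hv (U.smul_mem _ h0)
      · rwa [h0 v hv, mul_zero, zero_smul, sub_zero]
    refine ⟨h1, ?_⟩
    rwa [inv_eq_of_mul_eq_one_left hg.2.1]
  | one => simp
  | mul x y _ _ hx hy =>
    constructor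
    · intro v hv
      rw [GeneralLinearGroup.coe_mul, ← Matrix.mulVec_mulVec]
      exact hx.1 _ (hy.1 v hv)
    · intro v hv
      rw [_root_.mul_inv_rev, GeneralLinearGroup.coe_mul, ← Matrix.mulVec_mulVec]
      exact hy.2 _ (hx.2 v hv)
  | inv x _ hx => exact ⟨hx.2, by rw [inv_inv]; exact hx.1⟩

theorem span_roots_eq_top (hG : IsInvariantInnerProduct W G) (hW : IsReflectionGroup W)
    (hirr : IsIrreducible W) :
    Submodule.span ℝ (roots G hW.finite : Set (Fin ℓ → ℝ)) = ⊤ := by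
  refine (hG.eq_bot_or_eq_top hW hirr _ fun β hβ =>
    Or.inl (Submodule.subset_span ((mem_roots hW.finite).2 hβ))).resolve_left fun hbot => ?_
  refine hirr.ne_bot ?_
  rw [← hW.closure_eq, Subgroup.closure_eq_bot_iff]
  rintro g ⟨hg, hrefl⟩
  obtain ⟨β, hβ, -⟩ := hG.exists_isRoot_of_isReflection hg hrefl
  have h1 : β ∈ Submodule.span ℝ (roots G hW.finite : Set (Fin ℓ → ℝ)) :=
    Submodule.subset_span ((mem_roots hW.finite).2 hβ)
  rw [hbot, Submodule.mem_bot] at h1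
  exact absurd h1 ((hG.isUnitRootSystem hW.finite).ne_zero ((mem_roots hW.finite).2 hβ))

end IsInvariantInnerProduct

theorem exists_mulVec_eq_of_mem_closure (hW : Finite W)
    {g : Module.End ℝ (Fin ℓ → ℝ)}
    (hg : g ∈ Submonoid.closure (rootReflection (toBilin' G) '' (roots G hW : Set _))) :
    ∃ w ∈ W, ∀ x, (w : Matrix (Fin ℓ) (Fin ℓ) ℝ) *ᵥ x = g x := by
  induction hg using Submonoid.closure_induction with
  | mem x hx =>
    obtain ⟨β, hβ, rfl⟩ := hx
    exact ((mem_roots hW).1 hβ).2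
  | one => exact ⟨1, one_mem W, fun x => by simp⟩
  | mul x y _ _ hx hy =>
    obtain ⟨u, hu, hux⟩ := hx
    obtain ⟨v, hv, hvy⟩ := hy
    refine ⟨u * v, mul_mem hu hv, fun z => ?_⟩
    rw [GeneralLinearGroup.coe_mul, ← Matrix.mulVec_mulVec, hvy, hux, Module.End.mul_apply]

end GroupRoots

/-! ### The Jacobian determinant divides the product of the positive roots -/

section Jacobian

open Matrix

variable {ℓ : ℕ} {W : Subgroup (GL (Fin ℓ) ℝ)} {G : Matrix (Fin ℓ) (Fin ℓ) ℝ}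

/-- The linear form `(x, ·)` on `V`. -/
def linForm (G : Matrix (Fin ℓ) (Fin ℓ) ℝ) (x : Fin ℓ → ℝ) : MvPolynomial (Fin ℓ) ℂ :=
  ∑ i, C (((G *ᵥ x) i : ℝ) : ℂ) * X i

theorem linForm_sub (x y : Fin ℓ → ℝ) : linForm G (x - y) = linForm G x - linForm G y := by
  simp [linForm, mulVec_sub, sub_mul]

theorem linForm_add (x y : Fin ℓ → ℝ) : linForm G (x + y) = linForm G x + linForm G y := by
  simp [linForm, mulVec_add, add_mul, Finset.sum_add_distrib]

theorem linForm_smul (c : ℝ) (x : Fin ℓ → ℝ) :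
    linForm G (c • x) = C (c : ℂ) * linForm G x := by
  simp [linForm, mulVec_smul, Finset.mul_sum, mul_assoc]

theorem linForm_neg (x : Fin ℓ → ℝ) : linForm G (-x) = -linForm G x := by
  simp [linForm, mulVec_neg]

theorem linForm_isHomogeneous (x : Fin ℓ → ℝ) : (linForm G x).IsHomogeneous 1 :=
  IsHomogeneous.sum _ _ _ fun i _ => isHomogeneous_C_mul_X _ i

theorem pderiv_linForm (x : Fin ℓ → ℝ) (i : Fin ℓ) :
    pderiv i (linForm G x) = C (((G *ᵥ x) i : ℝ) : ℂ) := by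
  simp [linForm, Derivation.leibniz, pderiv_X, Pi.single_apply]

theorem eval_linForm (x : Fin ℓ → ℝ) (v : Fin ℓ → ℂ) :
    eval v (linForm G x) = ∑ i, (((G *ᵥ x) i : ℝ) : ℂ) * v i := by
  simp [linForm]

namespace IsInvariantInnerProduct

theorem linForm_eq_zero (hG : IsInvariantInnerProduct W G) {x : Fin ℓ → ℝ}
    (h : linForm G x = 0) : x = 0 := by
  have h1 : G *ᵥ x = 0 := by
    ext i
    have := congrArg (pderiv i) h
    rw [pderiv_linForm, map_zero, C_eq_zero] at this
    exact_mod_cast this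
  exact mulVec_injective_of_isUnit hG.posDef.isUnit (by rw [h1, mulVec_zero])

theorem linForm_ne_zero (hG : IsInvariantInnerProduct W G) {x : Fin ℓ → ℝ} (hx : x ≠ 0) :
    linForm G x ≠ 0 := fun h => hx (hG.linForm_eq_zero h)

theorem totalDegree_linForm (hG : IsInvariantInnerProduct W G) {x : Fin ℓ → ℝ} (hx : x ≠ 0) :
    (linForm G x).totalDegree = 1 :=
  (linForm_isHomogeneous x).totalDegree (hG.linForm_ne_zero hx)

theorem prime_linForm (hG : IsInvariantInnerProduct W G) {x : Fin ℓ → ℝ} (hx : x ≠ 0) :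
    Prime (linForm G x) := by
  refine (irreducible_of_totalDegree_eq_one (hG.totalDegree_linForm hx) fun a ha => ?_).prime
  rcases eq_or_ne a 0 with rfl | ha0
  · refine absurd (MvPolynomial.ext _ 0 fun d => ?_) (hG.linForm_ne_zero hx)
    rw [coeff_zero]
    exact zero_dvd_iff.1 (ha d)
  · exact ha0.isUnit

theorem contragredient_linForm (hG : IsInvariantInnerProduct W G) {w : GL (Fin ℓ) ℝ} (hw : w ∈ W)
    (x : Fin ℓ → ℝ) :
    contragredient w (linForm G x) = linForm G ((w : Matrix (Fin ℓ) (Fin ℓ) ℝ) *ᵥ x) := by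
  have h1 : G *ᵥ ((w : Matrix (Fin ℓ) (Fin ℓ) ℝ) *ᵥ x) =
      (G *ᵥ x) ᵥ* ((w⁻¹ : GL (Fin ℓ) ℝ) : Matrix (Fin ℓ) (Fin ℓ) ℝ) := by
    have h2 := hG.invariant w hw
    have h3 : (w : Matrix (Fin ℓ) (Fin ℓ) ℝ) * ((w⁻¹ : GL (Fin ℓ) ℝ) : Matrix _ _ ℝ) = 1 := by
      rw [← GeneralLinearGroup.coe_mul, mul_inv_cancel, GeneralLinearGroup.coe_one]
    have h4 : ((w⁻¹ : GL (Fin ℓ) ℝ) : Matrix (Fin ℓ) (Fin ℓ) ℝ)ᵀ *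
        (w : Matrix (Fin ℓ) (Fin ℓ) ℝ)ᵀ = 1 := by
      rw [← transpose_mul, h3, transpose_one]
    nth_rewrite 2 [← h2]
    rw [← mulVec_transpose, Matrix.mulVec_mulVec, Matrix.mulVec_mulVec, ← Matrix.mul_assoc,
      ← Matrix.mul_assoc, h4, Matrix.one_mul]
  simp only [linForm, h1, map_sum, map_mul, contragredient, algHom_C, aeval_X, algebraMap_eq]
  simp only [vecMul, dotProduct, Finset.mul_sum, Complex.ofReal_sum, Complex.ofReal_mul, map_sum,
    map_mul, Finset.sum_mul, mul_assoc]
  rw [Finset.sum_comm]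

/-- If one real linear form divides another, then the vectors are proportional over `ℝ`. -/
theorem exists_smul_of_linForm_dvd (hG : IsInvariantInnerProduct W G) {z y : Fin ℓ → ℝ}
    (hz : z ≠ 0) (h : linForm G z ∣ linForm G y) : ∃ c : ℝ, y = c • z := by
  rcases eq_or_ne y 0 with rfl | hy
  · exact ⟨0, (zero_smul ℝ z).symm⟩
  obtain ⟨g, hg⟩ := h
  have hg0 : g ≠ 0 := by
    rintro rfl
    exact hG.linForm_ne_zero hy (by rw [hg, mul_zero])
  have hdeg := totalDegree_mul_of_isDomain (hG.linForm_ne_zero hz) hg0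
  rw [← hg, hG.totalDegree_linForm hy, hG.totalDegree_linForm hz] at hdeg
  obtain ⟨a, rfl⟩ : ∃ a, g = C a := ⟨_, totalDegree_eq_zero_iff_eq_C.1 (by omega)⟩
  refine ⟨a.re, mulVec_injective_of_isUnit hG.posDef.isUnit ?_⟩
  ext i
  have h1 := congrArg (pderiv i) hg
  rw [Derivation.leibniz, pderiv_linForm, pderiv_C, smul_zero, zero_add, pderiv_linForm,
    smul_eq_mul, ← C_mul] at h1
  have h2 := congrArg Complex.re (C_injective _ _ h1)
  rw [mulVec_smul, Pi.smul_apply, smul_eq_mul]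
  simpa using h2

end IsInvariantInnerProduct

/-- The orbit of a vector under the finite group `W`. -/
def orbit (hW : Finite W) (x : Fin ℓ → ℝ) : Finset (Fin ℓ → ℝ) :=
  (Set.toFinite (Set.range fun w : W =>
    ((w : GL (Fin ℓ) ℝ) : Matrix (Fin ℓ) (Fin ℓ) ℝ) *ᵥ x)).toFinset

theorem mem_orbit (hW : Finite W) {x y : Fin ℓ → ℝ} :
    y ∈ orbit hW x ↔ ∃ w ∈ W, (w : Matrix (Fin ℓ) (Fin ℓ) ℝ) *ᵥ x = y := by
  simp [orbit]

theorem self_mem_orbit (hW : Finite W) (x : Fin ℓ → ℝ) : x ∈ orbit hW x :=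
  (mem_orbit hW).2 ⟨1, one_mem W, by simp⟩

open scoped Classical in
/-- The product of the differences `L - L'`, where `L = (x, ·)` and `L'` runs through the other
linear forms in the orbit of `L`. -/
def orbitDifferent (G : Matrix (Fin ℓ) (Fin ℓ) ℝ) (hW : Finite W) (x : Fin ℓ → ℝ) :
    MvPolynomial (Fin ℓ) ℂ :=
  ∏ y ∈ (orbit hW x).erase x, linForm G (x - y)

/-- The derivation that sends `f` to its gradient `(∂₁ f, …, ∂_ℓ f)`. -/
def grad (ℓ : ℕ) : Derivation ℂ (MvPolynomial (Fin ℓ) ℂ) (Fin ℓ → MvPolynomial (Fin ℓ) ℂ) :=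
  mkDerivation ℂ fun i => Pi.single i 1

theorem grad_apply (f : MvPolynomial (Fin ℓ) ℂ) (i : Fin ℓ) : grad ℓ f i = pderiv i f := by
  have : (LinearMap.proj (R := MvPolynomial (Fin ℓ) ℂ) (φ := fun _ => MvPolynomial (Fin ℓ) ℂ)
      i).compDer (grad ℓ) = pderiv i := by
    ext j
    simp [grad, mkDerivation_X, pderiv_X, Pi.single_apply, eq_comm]
  exact Derivation.congr_fun this f

/-- The Jacobian determinant of `p₁, …, p_ℓ`. -/
def jacobianDet (p : Fin ℓ → MvPolynomial (Fin ℓ) ℂ) : MvPolynomial (Fin ℓ) ℂ :=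
  (Matrix.of fun k i => pderiv i (p k)).det

/-- A derivation that kills the coefficients of a polynomial acts on its values by the chain
rule. -/
theorem derivation_eval {S M : Type*} [CommRing S] [Algebra ℂ S] [AddCommGroup M] [Module S M]
    [Module ℂ M] (D : Derivation ℂ S M) (P : Polynomial S) (hP : ∀ n, D (P.coeff n) = 0) (a : S) :
    D (P.eval a) = P.derivative.eval a • D a := by
  rw [Polynomial.eval_eq_sum, Polynomial.derivative_eval, Polynomial.sum, Polynomial.sum, map_sum,
    Finset.sum_smul]
  refine Finset.sum_congr rfl fun n _ => ?_
  rw [Derivation.leibniz, hP, smul_zero, add_zero, Derivation.leibniz_pow, mul_assoc, mul_smul,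
    mul_smul, Nat.cast_smul_eq_nsmul]

section BasicInvariants

variable {p : Fin ℓ → MvPolynomial (Fin ℓ) ℂ} {m : Fin ℓ → ℕ}

/-- Differentiate the equation `∏ (L - L') = 0`, in which `L'` runs through the orbit of `L`: the
coefficients of the polynomial `∏ (T - L')` are invariants, so that their differentials are
combinations of `dp₁, …, dp_ℓ`. -/
theorem IsBasicInvariants.orbitDifferent_smul_grad_mem (hp : IsBasicInvariants W p m)
    (hG : IsInvariantInnerProduct W G) (hW : Finite W) (x : Fin ℓ → ℝ) :
    orbitDifferent G hW x • grad ℓ (linForm G x) ∈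
      Submodule.span (MvPolynomial (Fin ℓ) ℂ) (Set.range fun k => grad ℓ (p k)) := by
  classical
  set N := Submodule.span (MvPolynomial (Fin ℓ) ℂ) (Set.range fun k => grad ℓ (p k)) with hN
  let D := N.mkQ.compDer (grad ℓ)
  have hD : ∀ f, D f = N.mkQ (grad ℓ f) := fun f => rfl
  have hDinv : ∀ f ∈ invariants W, D f = 0 := by
    intro f hf
    rw [← hp.adjoin_eq] at hf
    refine Derivation.eqOn_adjoin (D1 := D) (D2 := 0) ?_ hf
    rintro _ ⟨k, rfl⟩
    rw [hD, Derivation.zero_apply, Submodule.mkQ_apply, Submodule.Quotient.mk_eq_zero]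
    exact Submodule.subset_span ⟨k, rfl⟩
  set P := Lagrange.nodal (orbit hW x) (linForm G) with hP
  have hcoeff : ∀ n, P.coeff n ∈ invariants W := by
    intro n w hw
    have hmap : P.map (contragredient w : MvPolynomial (Fin ℓ) ℂ →+* _) = P := by
      rw [hP, Lagrange.nodal, Polynomial.map_prod]
      have hinj := mulVec_injective_GL w
      have himg : (orbit hW x).image (fun y => (w : Matrix (Fin ℓ) (Fin ℓ) ℝ) *ᵥ y) =
          orbit hW x := by
        refine Finset.eq_of_subset_of_card_le (fun y hy => ?_)
          (Finset.card_image_of_injective _ hinj).ge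
        obtain ⟨z, hz, rfl⟩ := Finset.mem_image.1 hy
        obtain ⟨u, hu, rfl⟩ := (mem_orbit hW).1 hz
        exact (mem_orbit hW).2 ⟨w * u, mul_mem hw hu, by
          rw [GeneralLinearGroup.coe_mul, ← Matrix.mulVec_mulVec]⟩
      nth_rewrite 2 [← himg]
      rw [Finset.prod_image hinj.injOn]
      refine Finset.prod_congr rfl fun y _ => ?_
      rw [Polynomial.map_sub, Polynomial.map_X, Polynomial.map_C,
        ← hG.contragredient_linForm hw]
      rfl
    have := congrArg (fun Q => Q.coeff n) hmap
    simpa [Polynomial.coeff_map] using this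
  have h1 := derivation_eval D P (fun n => hDinv _ (hcoeff n)) (linForm G x)
  rw [hP, Lagrange.eval_nodal_at_node (self_mem_orbit hW x), map_zero,
    Lagrange.eval_nodal_derivative_eval_node_eq (self_mem_orbit hW x), Lagrange.eval_nodal] at h1
  rw [← Submodule.Quotient.mk_eq_zero, Submodule.Quotient.mk_smul, orbitDifferent]
  rw [eq_comm] at h1
  convert h1 using 2
  · exact Finset.prod_congr rfl fun y _ => linForm_sub x y
  · rfl

theorem IsBasicInvariants.jacobianDet_dvd_prod_orbitDifferent (hp : IsBasicInvariants W p m)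
    (hG : IsInvariantInnerProduct W G) (hW : Finite W)
    (b : Module.Basis (Fin ℓ) ℝ (Fin ℓ → ℝ)) :
    jacobianDet p ∣ ∏ i, orbitDifferent G hW (b i) := by
  have hex : ∀ i, ∃ a : Fin ℓ → MvPolynomial (Fin ℓ) ℂ,
      ∑ k, a k • grad ℓ (p k) = orbitDifferent G hW (b i) • grad ℓ (linForm G (b i)) := fun i =>
    (Submodule.mem_span_range_iff_exists_fun _).1 (hp.orbitDifferent_smul_grad_mem hG hW (b i))
  choose a ha using hex
  let Y : Matrix (Fin ℓ) (Fin ℓ) ℝ := Matrix.of fun i => G *ᵥ b i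
  have hY : IsUnit Y := by
    rw [← linearIndependent_rows_iff_isUnit]
    exact b.linearIndependent.map' G.mulVecLin
      (LinearMap.ker_eq_bot.2 (mulVec_injective_of_isUnit hG.posDef.isUnit))
  let Y' : Matrix (Fin ℓ) (Fin ℓ) (MvPolynomial (Fin ℓ) ℂ) :=
    ((C : ℂ →+* MvPolynomial (Fin ℓ) ℂ).comp Complex.ofRealHom).mapMatrix Y
  have hmul : diagonal (fun i => orbitDifferent G hW (b i)) * Y' =
      Matrix.of a * Matrix.of fun k i => pderiv i (p k) := by
    ext1 i j
    have h1 := congrFun (ha i) j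
    simp only [Finset.sum_apply, Pi.smul_apply, grad_apply, smul_eq_mul, pderiv_linForm] at h1
    rw [diagonal_mul, mul_apply]
    exact h1.symm
  have hdet := congrArg det hmul
  rw [det_mul, det_diagonal, det_mul] at hdet
  have hunit : IsUnit Y'.det := by
    rw [← RingHom.map_det]
    exact ((isUnit_iff_isUnit_det Y).1 hY).map _
  exact (hunit.dvd_mul_right).1 (hdet ▸ Dvd.intro_left _ rfl)

end BasicInvariants

end Jacobian

section JacobianRoots

open Matrix

variable {ℓ : ℕ} {W : Subgroup (GL (Fin ℓ) ℝ)} {G : Matrix (Fin ℓ) (Fin ℓ) ℝ}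

theorem exists_basis_of_span_eq_top {T : Set (Fin ℓ → ℝ)} (hT : Submodule.span ℝ T = ⊤) :
    ∃ b : Module.Basis (Fin ℓ) ℝ (Fin ℓ → ℝ), ∀ i, b i ∈ T := by
  let b := Module.Basis.ofSpan hT.ge
  refine ⟨b.reindex (b.indexEquiv (Pi.basisFun ℝ (Fin ℓ))), fun i => ?_⟩
  rw [Module.Basis.reindex_apply]
  exact Module.Basis.ofSpan_subset hT.ge ⟨_, rfl⟩

/-- A squarefree element divides every element that is divisible by its prime factors. -/
theorem dvd_of_squarefree_of_forall_prime_dvd {R : Type*} [CommRing R] [IsDomain R]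
    [UniqueFactorizationMonoid R] {a : R} (ha : Squarefree a) (b : R)
    (h : ∀ q, Prime q → q ∣ a → q ∣ b) : a ∣ b := by
  induction a using UniqueFactorizationMonoid.induction_on_prime generalizing b with
  | h₁ => exact absurd ha not_squarefree_zero
  | h₂ x hx => exact hx.dvd
  | h₃ a q ha0 hq ih =>
    obtain ⟨c, rfl⟩ := ih (ha.squarefree_of_dvd (Dvd.intro_left q rfl)) b
      fun r hr hra => h r hr (hra.mul_left q)
    have hqa : ¬ q ∣ a := fun hqa => hq.not_isUnit (ha q (mul_dvd_mul_left q hqa))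
    have hqc := ((hq.dvd_mul).1 (h q hq (dvd_mul_right q a))).resolve_left hqa
    rw [mul_comm q a]
    exact mul_dvd_mul_left a hqc

namespace IsInvariantInnerProduct

theorem exists_isRoot_of_forall_dvd (hG : IsInvariantInnerProduct W G) {w : GL (Fin ℓ) ℝ}
    (hw : w ∈ W) (hw1 : w ≠ 1) {q : MvPolynomial (Fin ℓ) ℂ} (hq : Prime q)
    (h : ∀ x, q ∣ linForm G (x - (w : Matrix (Fin ℓ) (Fin ℓ) ℝ) *ᵥ x)) :
    ∃ β, IsRoot W G β ∧ Associated q (linForm G β) := by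
  obtain ⟨x, hx⟩ : ∃ x, (w : Matrix (Fin ℓ) (Fin ℓ) ℝ) *ᵥ x ≠ x := by
    by_contra! hall
    refine hw1 (GL_ext_mulVec fun x => ?_)
    rw [hall, GeneralLinearGroup.coe_one, one_mulVec]
  set z := x - (w : Matrix (Fin ℓ) (Fin ℓ) ℝ) *ᵥ x with hz
  have hz0 : z ≠ 0 := sub_ne_zero.2 (Ne.symm hx)
  have hass : Associated q (linForm G z) :=
    hq.irreducible.associated_of_dvd (hG.prime_linForm hz0).irreducible (h x)
  obtain ⟨β, hβ, ⟨r, hr, hzr⟩, -⟩ := hG.exists_isRoot hw hw1 hz0 fun y =>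
    hG.exists_smul_of_linForm_dvd hz0 (hass.symm.dvd.trans (h y))
  refine ⟨β, hβ, hass.trans ?_⟩
  rw [hzr, linForm_smul]
  refine associated_unit_mul_left _ _ ((isUnit_iff_ne_zero.2 ?_).map C)
  exact_mod_cast hr

/-- An isometry that moves `x` by a multiple of the root `β` fixes `x` or reflects it. -/
theorem eq_or_eq_of_sub_eq_smul (hG : IsInvariantInnerProduct W G) {w : GL (Fin ℓ) ℝ}
    (hw : w ∈ W) {β : Fin ℓ → ℝ} (hβ : IsRoot W G β) {x : Fin ℓ → ℝ} {c : ℝ}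
    (h : x - (w : Matrix (Fin ℓ) (Fin ℓ) ℝ) *ᵥ x = c • β) : c = 0 ∨ c = 2 * toBilin' G x β := by
  have h1 := hG.mulVec_mulVec hw x x
  have h2 : (w : Matrix (Fin ℓ) (Fin ℓ) ℝ) *ᵥ x = x - c • β := by rw [← h]; abel
  rw [h2] at h1
  simp only [map_sub, map_smul, LinearMap.sub_apply, LinearMap.smul_apply, smul_eq_mul,
    hβ.1] at h1
  rw [hG.symm β x] at h1
  have h3 : c * (c - 2 * toBilin' G x β) = 0 := by linarith
  rcases mul_eq_zero.1 h3 with h0 | h0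
  · exact Or.inl h0
  · exact Or.inr (by linarith)

theorem ne_zero_of_isRoot {β : Fin ℓ → ℝ} (hβ : IsRoot W G β) : β ≠ 0 := by
  rintro rfl
  simpa using hβ.1

/-- The linear form of a root does not divide the different of a vector orthogonal to the root. -/
theorem not_dvd_orbitDifferent (hG : IsInvariantInnerProduct W G) (hW : Finite W)
    {β : Fin ℓ → ℝ} (hβ : IsRoot W G β) {x : Fin ℓ → ℝ} (hx : toBilin' G x β = 0) :
    ¬ linForm G β ∣ orbitDifferent G hW x := by
  classical
  have hβ0 := ne_zero_of_isRoot hβ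
  intro hdvd
  obtain ⟨y, hy, hdvd⟩ := (hG.prime_linForm hβ0).exists_mem_finset_dvd hdvd
  obtain ⟨hyx, hy⟩ := Finset.mem_erase.1 hy
  obtain ⟨w, hw, rfl⟩ := (mem_orbit hW).1 hy
  obtain ⟨c, hc⟩ := hG.exists_smul_of_linForm_dvd hβ0 hdvd
  have hc0 : c = 0 := by
    rcases hG.eq_or_eq_of_sub_eq_smul hw hβ hc with h0 | h0
    · exact h0
    · rw [h0, hx, mul_zero]
  rw [hc0, zero_smul, sub_eq_zero] at hc
  exact hyx hc.symm

/-- The linear form of a root divides the different of this root exactly once: the only factor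
that it divides is the one of `-β`. -/
theorem exists_orbitDifferent_eq_mul (hG : IsInvariantInnerProduct W G) (hW : Finite W)
    {β : Fin ℓ → ℝ} (hβ : IsRoot W G β) :
    ∃ g, orbitDifferent G hW β = linForm G β * g ∧ ¬ linForm G β ∣ g := by
  classical
  have hβ0 := ne_zero_of_isRoot hβ
  have hprime := hG.prime_linForm hβ0
  have hneg : -β ∈ (orbit hW β).erase β := by
    refine Finset.mem_erase.2 ⟨fun h => hβ0 (self_eq_neg.1 h.symm), (mem_orbit hW).2 ?_⟩
    obtain ⟨h1, w, hw, hwβ⟩ := hβ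
    refine ⟨w, hw, ?_⟩
    rw [hwβ, rootReflection_apply, h1]
    module
  refine ⟨C 2 * ∏ y ∈ ((orbit hW β).erase β).erase (-β), linForm G (β - y), ?_, ?_⟩
  · rw [orbitDifferent, ← Finset.mul_prod_erase _ _ hneg, sub_neg_eq_add, linForm_add]
    rw [show (C 2 : MvPolynomial (Fin ℓ) ℂ) = 2 from map_ofNat C 2]
    ring
  · intro hdvd
    rcases hprime.dvd_or_dvd hdvd with hdvd | hdvd
    · exact hprime.not_isUnit (isUnit_of_dvd_unit hdvd ((isUnit_iff_ne_zero.2 two_ne_zero).map C))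
    obtain ⟨y, hy, hdvd⟩ := hprime.exists_mem_finset_dvd hdvd
    obtain ⟨hyneg, hy⟩ := Finset.mem_erase.1 hy
    obtain ⟨hyβ, hy⟩ := Finset.mem_erase.1 hy
    obtain ⟨w, hw, rfl⟩ := (mem_orbit hW).1 hy
    obtain ⟨c, hc⟩ := hG.exists_smul_of_linForm_dvd hβ0 hdvd
    rcases hG.eq_or_eq_of_sub_eq_smul hw hβ hc with h0 | h0
    · rw [h0, zero_smul, sub_eq_zero] at hc
      exact hyβ hc.symm
    · rw [h0, hβ.1, mul_one, two_smul, sub_eq_iff_eq_add] at hc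
      refine hyneg ?_
      rw [add_assoc, left_eq_add] at hc
      exact (neg_eq_of_add_eq_zero_right hc).symm

end IsInvariantInnerProduct

namespace IsBasicInvariants

variable {p : Fin ℓ → MvPolynomial (Fin ℓ) ℂ} {m : Fin ℓ → ℕ}

/-- A prime factor of the Jacobian determinant is the linear form of a root: otherwise there would
be a basis whose differents are not divisible by it. -/
theorem exists_isRoot_of_prime_dvd (hp : IsBasicInvariants W p m)
    (hG : IsInvariantInnerProduct W G) (hW : Finite W) {q : MvPolynomial (Fin ℓ) ℂ}
    (hq : Prime q) (hdvd : q ∣ jacobianDet p) :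
    ∃ β, IsRoot W G β ∧ Associated q (linForm G β) := by
  classical
  let U : GL (Fin ℓ) ℝ → Submodule ℝ (Fin ℓ → ℝ) := fun w =>
    { carrier := {x | q ∣ linForm G (x - (w : Matrix (Fin ℓ) (Fin ℓ) ℝ) *ᵥ x)}
      zero_mem' := by simp [linForm]
      add_mem' := fun {x y} hx hy => by
        have : x + y - (w : Matrix (Fin ℓ) (Fin ℓ) ℝ) *ᵥ (x + y) =
            (x - (w : Matrix (Fin ℓ) (Fin ℓ) ℝ) *ᵥ x) +
              (y - (w : Matrix (Fin ℓ) (Fin ℓ) ℝ) *ᵥ y) := by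
          rw [mulVec_add]; abel
        change q ∣ _
        rw [this, linForm_add]
        exact dvd_add hx hy
      smul_mem' := fun c x hx => by
        change q ∣ _
        rw [mulVec_smul, ← smul_sub, linForm_smul]
        exact Dvd.dvd.mul_left hx _ }
  by_cases htop : ∃ w ∈ W, w ≠ 1 ∧ U w = ⊤
  · obtain ⟨w, hw, hw1, hU⟩ := htop
    refine hG.exists_isRoot_of_forall_dvd hw hw1 hq fun x => ?_
    have : x ∈ U w := hU ▸ Submodule.mem_top
    exact this
  push Not at htop
  exfalso
  let T : Set (Fin ℓ → ℝ) := {x | ∀ w ∈ W, w ≠ 1 → x ∉ U w}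
  have hT : Submodule.span ℝ T = ⊤ := by
    by_contra hne
    let F : Option {w : W // (w : GL (Fin ℓ) ℝ) ≠ 1} → Submodule ℝ (Fin ℓ → ℝ) := fun o =>
      o.elim (Submodule.span ℝ T) fun w => U w
    obtain ⟨x, hx⟩ := Submodule.exists_forall_notMem_of_forall_ne_top F (by
      rintro (_ | w)
      · exact hne
      · exact htop w w.1.2 w.2)
    exact hx none (Submodule.subset_span fun w hw hw1 => hx (some ⟨⟨w, hw⟩, hw1⟩))
  obtain ⟨b, hb⟩ := exists_basis_of_span_eq_top hT
  obtain ⟨i, -, hi⟩ := hq.exists_mem_finset_dvd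
    (hdvd.trans (hp.jacobianDet_dvd_prod_orbitDifferent hG hW b))
  obtain ⟨y, hy, hdvd'⟩ := hq.exists_mem_finset_dvd hi
  obtain ⟨hyb, hy⟩ := Finset.mem_erase.1 hy
  obtain ⟨w, hw, rfl⟩ := (mem_orbit hW).1 hy
  refine hb i w hw ?_ hdvd'
  rintro rfl
  simp at hyb

theorem not_sq_dvd_jacobianDet (hp : IsBasicInvariants W p m)
    (hG : IsInvariantInnerProduct W G) (hW : Finite W) {β : Fin ℓ → ℝ} (hβ : IsRoot W G β) :
    ¬ linForm G β * linForm G β ∣ jacobianDet p := by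
  classical
  have hprime := hG.prime_linForm (IsInvariantInnerProduct.ne_zero_of_isRoot hβ)
  have hT : Submodule.span ℝ (insert β {x | toBilin' G x β = 0}) = ⊤ := by
    rw [eq_top_iff]
    intro x _
    have h1 : x = (x - toBilin' G x β • β) + toBilin' G x β • β := by abel
    rw [h1]
    refine Submodule.add_mem _ (Submodule.subset_span (Or.inr ?_))
      (Submodule.smul_mem _ _ (Submodule.subset_span (Set.mem_insert _ _)))
    change toBilin' G _ β = 0
    rw [map_sub, LinearMap.sub_apply, map_smul (toBilin' G), LinearMap.smul_apply, hβ.1,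
      smul_eq_mul, mul_one, sub_self]
  obtain ⟨b, hb⟩ := exists_basis_of_span_eq_top hT
  have hdvd := hp.jacobianDet_dvd_prod_orbitDifferent hG hW b
  intro hsq
  have hsq' := hsq.trans hdvd
  have hnot : ∀ s : Finset (Fin ℓ), (∀ i ∈ s, b i ≠ β) →
      ¬ linForm G β ∣ ∏ i ∈ s, orbitDifferent G hW (b i) := by
    intro s hs h
    obtain ⟨i, hi, h⟩ := hprime.exists_mem_finset_dvd h
    exact hG.not_dvd_orbitDifferent hW hβ ((hb i).resolve_left (hs i hi)) h
  by_cases hex : ∃ i, b i = β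
  · obtain ⟨i, hi⟩ := hex
    obtain ⟨g, hg, hgn⟩ := hG.exists_orbitDifferent_eq_mul hW hβ
    rw [← Finset.mul_prod_erase _ _ (Finset.mem_univ i), hi, hg, mul_assoc] at hsq'
    rcases hprime.dvd_or_dvd ((mul_dvd_mul_iff_left hprime.ne_zero).1 hsq') with h | h
    · exact hgn h
    · refine hnot _ (fun j hj h => ?_) h
      exact (Finset.mem_erase.1 hj).1 (b.injective (h.trans hi.symm))
  · push Not at hex
    exact hnot _ (fun i _ => hex i) ((dvd_mul_right _ _).trans hsq')

theorem jacobianDet_ne_zero (hp : IsBasicInvariants W p m)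
    (hG : IsInvariantInnerProduct W G) (hW : Finite W) : jacobianDet p ≠ 0 := by
  classical
  intro h0
  have h1 := hp.jacobianDet_dvd_prod_orbitDifferent hG hW (Pi.basisFun ℝ (Fin ℓ))
  rw [h0, zero_dvd_iff, Finset.prod_eq_zero_iff] at h1
  obtain ⟨i, -, hi⟩ := h1
  obtain ⟨y, hy, hy0⟩ := Finset.prod_eq_zero_iff.1 hi
  exact (Finset.mem_erase.1 hy).1 (sub_eq_zero.1 (hG.linForm_eq_zero hy0)).symm

/-- The Jacobian determinant is squarefree, and its prime factors are linear forms of roots. -/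
theorem jacobianDet_dvd_prod_roots (hp : IsBasicInvariants W p m)
    (hG : IsInvariantInnerProduct W G) (hW : Finite W) {P : Finset (Fin ℓ → ℝ)}
    (hP : ∀ β, IsRoot W G β → β ∈ P ∨ -β ∈ P) :
    jacobianDet p ∣ ∏ β ∈ P, linForm G β := by
  refine dvd_of_squarefree_of_forall_prime_dvd ?_ _ fun q hq hdvd => ?_
  · rw [squarefree_iff_irreducible_sq_not_dvd_of_ne_zero (hp.jacobianDet_ne_zero hG hW)]
    intro q hq hdvd
    obtain ⟨β, hβ, hass⟩ := hp.exists_isRoot_of_prime_dvd hG hW hq.prime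
      ((dvd_mul_right q q).trans hdvd)
    exact hp.not_sq_dvd_jacobianDet hG hW hβ ((hass.mul_mul hass).symm.dvd.trans hdvd)
  · obtain ⟨β, hβ, hass⟩ := hp.exists_isRoot_of_prime_dvd hG hW hq hdvd
    rcases hP β hβ with h | h
    · exact hass.dvd.trans (Finset.dvd_prod_of_mem _ h)
    · refine Dvd.dvd.trans ?_ (Finset.dvd_prod_of_mem _ h)
      rw [linForm_neg, dvd_neg]
      exact hass.dvd

theorem jacobianDet_isHomogeneous (hp : IsBasicInvariants W p m) :
    (jacobianDet p).IsHomogeneous (∑ i, m i) := by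
  rw [jacobianDet, det_apply]
  refine IsHomogeneous.sum _ _ _ fun σ _ => ?_
  have h1 : (∏ i, (Matrix.of fun k i => pderiv i (p k)) (σ i) i).IsHomogeneous (∑ i, m i) := by
    rw [← Equiv.sum_comp σ m]
    exact IsHomogeneous.prod _ _ _ fun i _ => (hp.isHomogeneous (σ i)).pderiv
  rcases Int.units_eq_one_or (Equiv.Perm.sign σ) with h | h <;> rw [h]
  · simpa using h1
  · simpa using h1.neg

theorem sum_le_card (hp : IsBasicInvariants W p m)
    (hG : IsInvariantInnerProduct W G) (hW : Finite W) {P : Finset (Fin ℓ → ℝ)}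
    (hP : ∀ β, IsRoot W G β → β ∈ P ∨ -β ∈ P) (hP' : ∀ β ∈ P, IsRoot W G β) :
    ∑ i, m i ≤ P.card := by
  obtain ⟨g, hg⟩ := hp.jacobianDet_dvd_prod_roots hG hW hP
  have hne : ∏ β ∈ P, linForm G β ≠ 0 := Finset.prod_ne_zero_iff.2 fun β hβ =>
    hG.linForm_ne_zero (IsInvariantInnerProduct.ne_zero_of_isRoot (hP' β hβ))
  have hg0 : g ≠ 0 := by
    rintro rfl
    exact hne (by rw [hg, mul_zero])
  have hJ := hp.jacobianDet_ne_zero hG hW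
  have hdeg := totalDegree_mul_of_isDomain hJ hg0
  rw [← hg, hp.jacobianDet_isHomogeneous.totalDegree hJ] at hdeg
  have hle : (∏ β ∈ P, linForm G β).totalDegree ≤ ∑ β ∈ P, 1 :=
    (IsHomogeneous.prod P _ (fun _ => 1) fun β _ => linForm_isHomogeneous β).totalDegree_le
  rw [Finset.sum_const, smul_eq_mul, mul_one] at hle
  omega

end IsBasicInvariants

end JacobianRoots

/-! ### A regular eigenvector -/

section Eigenvector

open Matrix

variable {ℓ : ℕ} {W : Subgroup (GL (Fin ℓ) ℝ)} {G : Matrix (Fin ℓ) (Fin ℓ) ℝ}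

/-- A real matrix, regarded as a complex one. -/
def complexMatrix (A : Matrix (Fin ℓ) (Fin ℓ) ℝ) : Matrix (Fin ℓ) (Fin ℓ) ℂ :=
  A.map Complex.ofRealHom

theorem complexMatrix_mul (A A' : Matrix (Fin ℓ) (Fin ℓ) ℝ) :
    complexMatrix (A * A') = complexMatrix A * complexMatrix A' :=
  Matrix.map_mul

theorem complexMatrix_one : complexMatrix (1 : Matrix (Fin ℓ) (Fin ℓ) ℝ) = 1 :=
  Matrix.map_one _ (map_zero _) (map_one _)

theorem complexMatrix_inv_mulVec {w : GL (Fin ℓ) ℝ} {v : Fin ℓ → ℂ} {ζ : ℂ} (hζ : ζ ≠ 0)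
    (h : complexMatrix (w : Matrix (Fin ℓ) (Fin ℓ) ℝ) *ᵥ v = ζ • v) :
    complexMatrix ((w⁻¹ : GL (Fin ℓ) ℝ) : Matrix (Fin ℓ) (Fin ℓ) ℝ) *ᵥ v = ζ⁻¹ • v := by
  have h1 : v = ζ⁻¹ • (complexMatrix (w : Matrix (Fin ℓ) (Fin ℓ) ℝ) *ᵥ v) := by
    rw [h, inv_smul_smul₀ hζ]
  nth_rewrite 1 [h1]
  rw [mulVec_smul, mulVec_mulVec, ← complexMatrix_mul, ← GeneralLinearGroup.coe_mul,
    inv_mul_cancel, GeneralLinearGroup.coe_one, complexMatrix_one, one_mulVec]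

theorem eval_contragredient (w : GL (Fin ℓ) ℝ) (f : MvPolynomial (Fin ℓ) ℂ) (u : Fin ℓ → ℂ) :
    eval u (contragredient w f) =
      eval (complexMatrix ((w⁻¹ : GL (Fin ℓ) ℝ) : Matrix (Fin ℓ) (Fin ℓ) ℝ) *ᵥ u) f := by
  induction f using MvPolynomial.induction_on with
  | C a => simp [contragredient]
  | add f g hf hg => rw [map_add, map_add, map_add, hf, hg]
  | mul_X f i hf =>
    rw [map_mul, map_mul, map_mul, hf]
    congr 1
    simp [contragredient, complexMatrix, mulVec, dotProduct]

theorem pderiv_contragredient (w : GL (Fin ℓ) ℝ) (f : MvPolynomial (Fin ℓ) ℂ) (j : Fin ℓ) :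
    pderiv j (contragredient w f) = ∑ i, contragredient w (pderiv i f) *
      C ((((w⁻¹ : GL (Fin ℓ) ℝ) : Matrix (Fin ℓ) (Fin ℓ) ℝ) i j : ℝ) : ℂ) := by
  induction f using MvPolynomial.induction_on with
  | C a => simp [contragredient]
  | add f g hf hg => simp only [map_add, hf, hg, add_mul, Finset.sum_add_distrib]
  | mul_X f k hf =>
    have hX : pderiv j (contragredient w (X k)) =
        C ((((w⁻¹ : GL (Fin ℓ) ℝ) : Matrix (Fin ℓ) (Fin ℓ) ℝ) k j : ℝ) : ℂ) := by
      simp [contragredient, Derivation.leibniz, pderiv_X, Pi.single_apply]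
    have hs : ∀ i, contragredient w (pderiv i (X k : MvPolynomial (Fin ℓ) ℂ)) =
        if i = k then 1 else 0 := by
      intro i
      by_cases hik : i = k
      · rw [hik, pderiv_X_self, map_one, if_pos rfl]
      · rw [pderiv_X_of_ne (Ne.symm hik), map_zero, if_neg hik]
    simp only [map_mul, Derivation.leibniz, hX, hf, smul_eq_mul, map_add, hs, add_mul,
      Finset.sum_add_distrib, mul_ite, mul_one, mul_zero, ite_mul, zero_mul, Finset.sum_ite_eq',
      Finset.mem_univ, if_true, Finset.mul_sum, mul_assoc]

theorem eval_smul_of_isHomogeneous {f : MvPolynomial (Fin ℓ) ℂ} {d : ℕ} (hf : f.IsHomogeneous d)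
    (t : ℂ) (v : Fin ℓ → ℂ) : eval (t • v) f = t ^ d * eval v f := by
  rw [eval_eq, eval_eq, Finset.mul_sum]
  refine Finset.sum_congr rfl fun e he => ?_
  have hd := hf.degree_eq_sum_deg_support he
  simp only [Pi.smul_apply, smul_eq_mul, mul_pow, Finset.prod_mul_distrib,
    Finset.prod_pow_eq_pow_sum]
  rw [← hd]
  ring

theorem eval_smul_of_mem_invariants {f : MvPolynomial (Fin ℓ) ℂ} (hf : f ∈ invariants W)
    {w : GL (Fin ℓ) ℝ} (hw : w ∈ W) {v : Fin ℓ → ℂ} {ζ : ℂ}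
    (h : complexMatrix (w : Matrix (Fin ℓ) (Fin ℓ) ℝ) *ᵥ v = ζ • v) :
    eval (ζ • v) f = eval v f := by
  have h1 := eval_contragredient w f (ζ • v)
  rw [hf w hw] at h1
  rw [h1, ← h, mulVec_mulVec, ← complexMatrix_mul, ← GeneralLinearGroup.coe_mul, inv_mul_cancel,
    GeneralLinearGroup.coe_one, complexMatrix_one, one_mulVec]

/-- If `v` is an eigenvector with eigenvalue a primitive `n`-th root of unity, then the elements
of `F` of degree less than `n` vanish at `v`: on the line of `v` an invariant is a polynomial in the
`n`-th power of the coordinate. -/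
theorem eval_eq_zero_of_mem_invariantIdeal {f : MvPolynomial (Fin ℓ) ℂ} (hf : f ∈ invariantIdeal W)
    {d n : ℕ} (hd : f.IsHomogeneous d) (hdn : d < n) {w : GL (Fin ℓ) ℝ} (hw : w ∈ W)
    {v : Fin ℓ → ℂ} {ζ : ℂ} (hζ : IsPrimitiveRoot ζ n)
    (h : complexMatrix (w : Matrix (Fin ℓ) (Fin ℓ) ℝ) *ᵥ v = ζ • v) : eval v f = 0 := by
  let τ : MvPolynomial (Fin ℓ) ℂ →ₐ[ℂ] Polynomial ℂ :=
    aeval fun i => Polynomial.C (v i) * Polynomial.X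
  have hτ : ∀ g t, (τ g).eval t = eval (t • v) g := by
    intro g t
    induction g using MvPolynomial.induction_on with
    | C a => simp [τ]
    | add g g' hg hg' => rw [map_add, map_add, Polynomial.eval_add, hg, hg']
    | mul_X g i hg =>
      rw [map_mul, map_mul, Polynomial.eval_mul, hg]
      congr 1
      simp only [τ, aeval_X, Polynomial.eval_mul, Polynomial.eval_C, Polynomial.eval_X, eval_X,
        Pi.smul_apply, smul_eq_mul]
      exact mul_comm _ _
  have hdvd : Polynomial.X ^ n ∣ τ f := by
    clear hd
    induction hf using Submodule.span_induction with
    | mem g hg =>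
      obtain ⟨hg, hg0⟩ := hg
      have hcomp : (τ g).comp (Polynomial.C ζ * Polynomial.X) = τ g := by
        refine Polynomial.funext fun t => ?_
        rw [Polynomial.eval_comp, Polynomial.eval_mul, Polynomial.eval_C, Polynomial.eval_X,
          hτ, hτ, mul_smul]
        refine eval_smul_of_mem_invariants hg hw ?_
        rw [mulVec_smul, h, smul_comm]
      rw [Polynomial.X_pow_dvd_iff]
      intro k hk
      rcases Nat.eq_zero_or_pos k with rfl | hk0
      · rw [Polynomial.coeff_zero_eq_eval_zero, hτ, zero_smul, eval_zero, hg0]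
      · have h1 := congrArg (fun Q => Q.coeff k) hcomp
        simp only [Polynomial.comp_C_mul_X_coeff] at h1
        by_contra hne
        have h2 : ζ ^ k = 1 := by
          refine mul_left_cancel₀ hne ?_
          rw [h1, mul_one]
        exact absurd (Nat.le_of_dvd hk0 (hζ.dvd_of_pow_eq_one k h2)) (not_le.2 hk)
    | zero => rw [map_zero]; exact dvd_zero _
    | add x y _ _ hx hy => rw [map_add]; exact dvd_add hx hy
    | smul a x _ hx => rw [smul_eq_mul, map_mul]; exact Dvd.dvd.mul_left hx _
  have hmon : τ f = Polynomial.C (eval v f) * Polynomial.X ^ d := by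
    refine Polynomial.funext fun t => ?_
    rw [hτ, eval_smul_of_isHomogeneous hd, Polynomial.eval_mul, Polynomial.eval_C,
      Polynomial.eval_pow, Polynomial.eval_X, mul_comm]
  have h1 := Polynomial.X_pow_dvd_iff.1 hdvd d hdn
  simpa [hmon] using h1

end Eigenvector

/-! ### The Hessian rank condition -/

section HessianRank

open Matrix

variable {ℓ : ℕ} {W : Subgroup (GL (Fin ℓ) ℝ)} {G : Matrix (Fin ℓ) (Fin ℓ) ℝ}

theorem eval_linForm_sub_I_smul (hG : IsInvariantInnerProduct W G) (e₀ e₁ β : Fin ℓ → ℝ) :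
    eval (fun i => (e₀ i : ℂ) - Complex.I * (e₁ i : ℂ)) (linForm G β) =
      (toBilin' G β e₀ : ℂ) - Complex.I * (toBilin' G β e₁ : ℂ) := by
  have h1 : ∀ e : Fin ℓ → ℝ, (toBilin' G β e : ℂ) = ∑ i, (((G *ᵥ β) i : ℝ) : ℂ) * (e i : ℂ) := by
    intro e
    rw [hG.symm, toBilin'_apply', dotProduct, Complex.ofReal_sum]
    exact Finset.sum_congr rfl fun i _ => by rw [Complex.ofReal_mul, mul_comm]
  rw [eval_linForm, h1, h1, Finset.mul_sum, ← Finset.sum_sub_distrib]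
  exact Finset.sum_congr rfl fun i _ => by ring

/-- The eigenvector of a Coxeter element in the complexified Coxeter plane. -/
theorem exists_regular_eigenvector [NeZero ℓ] (hG : IsInvariantInnerProduct W G)
    (hW : IsReflectionGroup W) (hirr : IsIrreducible W) :
    ∃ w ∈ W, ∃ (n : ℕ) (v : Fin ℓ → ℂ) (ζ : ℂ), IsPrimitiveRoot ζ n ∧ 0 < n ∧
      complexMatrix (w : Matrix (Fin ℓ) (Fin ℓ) ℝ) *ᵥ v = ζ • v ∧
      (∀ β, IsRoot W G β → eval v (linForm G β) ≠ 0) ∧ (roots G hW.finite).card ≤ ℓ * n := by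
  obtain ⟨g, hg, n, e₀, e₁, hn, hg₀, hg₁, hne, hcard⟩ :=
    (hG.isUnitRootSystem hW.finite).exists_coxeter_plane (hG.span_roots_eq_top hW hirr)
      fun U hU => hG.eq_bot_or_eq_top hW hirr U fun β hβ =>
        hU β ((mem_roots hW.finite).2 hβ)
  obtain ⟨w, hw, hwg⟩ := exists_mulVec_eq_of_mem_closure hW.finite hg
  rw [Module.finrank_fin_fun] at hcard
  refine ⟨w, hw, n, fun i => (e₀ i : ℂ) - Complex.I * (e₁ i : ℂ), _,
    Complex.isPrimitiveRoot_exp n hn.ne', hn, ?_, fun β hβ => ?_, hcard⟩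
  · have hcm : ∀ e : Fin ℓ → ℝ, ∀ i,
        ∑ j, complexMatrix (w : Matrix (Fin ℓ) (Fin ℓ) ℝ) i j * (e j : ℂ) = ((g e i : ℝ) : ℂ) := by
      intro e i
      rw [← hwg]
      simp [complexMatrix, mulVec, dotProduct]
    ext i
    set φ : ℝ := 2 * Real.pi / n with hφ
    have hexp : Complex.exp (2 * Real.pi * Complex.I / n) =
        (Real.cos φ : ℂ) + Real.sin φ * Complex.I := by
      rw [Complex.ofReal_cos, Complex.ofReal_sin, ← Complex.exp_mul_I]
      congr 1
      rw [hφ]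
      push_cast
      ring
    have h0 := hcm e₀ i
    have h1 := hcm e₁ i
    rw [hg₀] at h0
    rw [hg₁] at h1
    simp only [circle, Real.cos_add_pi_div_two, Real.sin_add_pi_div_two, Pi.add_apply,
      Pi.smul_apply, smul_eq_mul, Complex.ofReal_add, Complex.ofReal_mul, Complex.ofReal_neg]
      at h0 h1
    rw [hexp, mulVec, dotProduct, Pi.smul_apply, smul_eq_mul]
    simp only [mul_sub, Finset.sum_sub_distrib, h0, mul_left_comm _ Complex.I, ← Finset.mul_sum, h1]
    linear_combination ((Real.sin φ : ℂ) * (e₁ i : ℂ)) * Complex.I_mul_I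
  · rw [eval_linForm_sub_I_smul hG]
    intro h0
    have hre := congrArg Complex.re h0
    have him := congrArg Complex.im h0
    simp at hre him
    rcases hne β ((mem_roots hW.finite).2 hβ) with h1 | h1
    · exact h1 hre
    · exact h1 him

theorem exists_positive_roots (hG : IsInvariantInnerProduct W G) (hW : Finite W) :
    ∃ P : Finset (Fin ℓ → ℝ), (∀ β, IsRoot W G β → β ∈ P ∨ -β ∈ P) ∧ (∀ β ∈ P, IsRoot W G β) ∧
      2 * P.card ≤ (roots G hW).card := by
  classical
  have hΦ := hG.isUnitRootSystem hW
  obtain ⟨f, -, hf, -⟩ := hΦ.exists_isSimpleSystem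
  refine ⟨(roots G hW).filter fun β => 0 < f β, fun β hβ => ?_, fun β hβ => ?_, ?_⟩
  · have hβ' := (mem_roots hW).2 hβ
    rcases lt_or_gt_of_ne (hf β hβ') with h | h
    · exact Or.inr (Finset.mem_filter.2 ⟨hΦ.neg_mem hβ', by rw [map_neg]; linarith⟩)
    · exact Or.inl (Finset.mem_filter.2 ⟨hβ', h⟩)
  · exact (mem_roots hW).1 (Finset.mem_filter.1 hβ).1
  · rw [← Finset.card_filter_add_card_filter_not (s := roots G hW) (fun β => 0 < f β), two_mul]
    refine Nat.add_le_add_left (Finset.card_le_card_of_injOn (fun β => -β) ?_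
      neg_injective.injOn) _
    intro β hβ
    obtain ⟨hβ, hpos⟩ := Finset.mem_filter.1 (Finset.mem_coe.1 hβ)
    refine Finset.mem_coe.2 (Finset.mem_filter.2 ⟨hΦ.neg_mem hβ, ?_⟩)
    rw [map_neg]
    linarith

/-- The Jacobian matrix of `p₁, …, p_ℓ` at the point `v`. -/
def jacobianAt (p : Fin ℓ → MvPolynomial (Fin ℓ) ℂ) (v : Fin ℓ → ℂ) :
    Matrix (Fin ℓ) (Fin ℓ) ℂ :=
  Matrix.of fun i a => eval v (pderiv a (p i))

theorem gradField_apply (G : Matrix (Fin ℓ) (Fin ℓ) ℝ) (f g : MvPolynomial (Fin ℓ) ℂ) :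
    gradField G f g = ∑ a, (∑ k, C ((G⁻¹ a k : ℝ) : ℂ) * pderiv k f) * pderiv a g := by
  let c : Fin ℓ → MvPolynomial (Fin ℓ) ℂ := fun a => ∑ k, C ((G⁻¹ a k : ℝ) : ℂ) * pderiv k f
  let L : (Fin ℓ → MvPolynomial (Fin ℓ) ℂ) →ₗ[MvPolynomial (Fin ℓ) ℂ] MvPolynomial (Fin ℓ) ℂ :=
    ∑ a, c a • LinearMap.proj a
  have h1 : gradField G f = L.compDer (grad ℓ) := by
    ext1 j
    simp [gradField, grad, mkDerivation_X, L, c, Pi.single_apply]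
  have h2 : L.compDer (grad ℓ) g = ∑ a, c a * grad ℓ g a := by
    simp [L]
  rw [h1, h2]
  exact Finset.sum_congr rfl fun a _ => by rw [grad_apply]

/-- If `Hess(f)(η)` lies in `I Ω¹`, then so do its coefficients `η(∂ₖ f)` in `I`. -/
theorem apply_pderiv_mem_of_hess_mem {f : MvPolynomial (Fin ℓ) ℂ}
    {δ : Derivation ℂ (MvPolynomial (Fin ℓ) ℂ) (MvPolynomial (Fin ℓ) ℂ)}
    {I : Ideal (MvPolynomial (Fin ℓ) ℂ)}
    (h : hess f δ ∈
      I • (⊤ : Submodule (MvPolynomial (Fin ℓ) ℂ) Ω[MvPolynomial (Fin ℓ) ℂ⁄ℂ])) (k : Fin ℓ) :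
    δ (pderiv k f) ∈ I := by
  let b := KaehlerDifferential.mvPolynomialBasis ℂ (Fin ℓ)
  have hcoord : ∀ ω ∈ I • (⊤ : Submodule (MvPolynomial (Fin ℓ) ℂ) Ω[MvPolynomial (Fin ℓ) ℂ⁄ℂ]),
      b.coord k ω ∈ I := by
    intro ω hω
    induction hω using Submodule.smul_induction_on' with
    | smul r hr n hn => rw [map_smul]; exact I.mul_mem_right _ hr
    | add x hx y hy hx' hy' => rw [map_add]; exact I.add_mem hx' hy'
  have h1 := hcoord _ h
  have h2 : hess f δ = ∑ i, δ (pderiv i f) • b i := by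
    simp only [b, KaehlerDifferential.mvPolynomialBasis_apply]
    rfl
  rw [h2, map_sum, Finset.sum_eq_single k] at h1
  · simpa using h1
  · intro i _ hik
    rw [map_smul, b.coord_apply, b.repr_self, Finsupp.single_eq_of_ne (Ne.symm hik), smul_zero]
  · exact fun hk => absurd (Finset.mem_univ k) hk

namespace IsBasicInvariants

variable {p : Fin ℓ → MvPolynomial (Fin ℓ) ℂ} {m : Fin ℓ → ℕ}

theorem mem_invariants (hp : IsBasicInvariants W p m) (i : Fin ℓ) : p i ∈ invariants W := by
  rw [← hp.adjoin_eq]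
  exact Algebra.subset_adjoin ⟨i, rfl⟩

/-- There are no invariant linear forms, since the roots span the space. -/
theorem exponent_pos (hp : IsBasicInvariants W p m) (hG : IsInvariantInnerProduct W G)
    (hW : IsReflectionGroup W) (hirr : IsIrreducible W) (i : Fin ℓ) : 0 < m i := by
  rw [Nat.pos_iff_ne_zero]
  intro hm
  have hhom := hp.isHomogeneous i
  rw [hm, zero_add] at hhom
  have hex : ∀ a, ∃ c : ℂ, pderiv a (p i) = C c := fun a =>
    ⟨_, totalDegree_eq_zero_iff_eq_C.1 (Nat.le_zero.1 (hhom.pderiv (i := a)).totalDegree_le)⟩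
  choose c hc using hex
  have hform : p i = ∑ a, X a * C (c a) := by
    have := hhom.sum_X_mul_pderiv
    rw [one_smul] at this
    rw [← this]
    exact Finset.sum_congr rfl fun a _ => by rw [hc]
  let L : (Fin ℓ → ℝ) →ₗ[ℝ] ℂ := ∑ a, (LinearMap.proj (R := ℝ) (φ := fun _ => ℝ) a).smulRight (c a)
  have hL : ∀ x, L x = eval (fun a => (x a : ℂ)) (p i) := by
    intro x
    rw [hform]
    simp [L]
  have hroot : ∀ β, IsRoot W G β → L β = 0 := by
    rintro β ⟨hβ1, w, hw, hβ⟩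
    have h1 : complexMatrix (w : Matrix (Fin ℓ) (Fin ℓ) ℝ) *ᵥ (fun a => (β a : ℂ)) =
        (-1 : ℂ) • fun a => (β a : ℂ) := by
      have h2 : (w : Matrix (Fin ℓ) (Fin ℓ) ℝ) *ᵥ β = -β := by
        rw [hβ, rootReflection_apply, hβ1]
        module
      ext a
      have h3 := congrArg (Complex.ofReal) (congrFun h2 a)
      simpa [complexMatrix, mulVec, dotProduct] using h3
    have h2 := eval_smul_of_mem_invariants (hp.mem_invariants i) hw h1
    rw [eval_smul_of_isHomogeneous hhom, ← hL] at h2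
    have h3 : (2 : ℂ) * L β = 0 := by linear_combination -h2
    exact (mul_eq_zero.1 h3).resolve_left two_ne_zero
  have hL0 : L = 0 := by
    refine LinearMap.ext_on (hG.span_roots_eq_top hW hirr) fun β hβ => ?_
    rw [hroot β ((mem_roots hW.finite).1 hβ), LinearMap.zero_apply]
  refine hp.algebraicIndependent.ne_zero i ?_
  rw [hform]
  refine Finset.sum_eq_zero fun a _ => ?_
  have h1 : L (Pi.single a 1) = 0 := by rw [hL0, LinearMap.zero_apply]
  have h2 : L (Pi.single a 1) = c a := by
    simp only [L, LinearMap.sum_apply, LinearMap.smulRight_apply, LinearMap.proj_apply]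
    rw [Finset.sum_eq_single a (fun b _ hb => by rw [Pi.single_eq_of_ne hb, zero_smul]) (by simp),
      Pi.single_eq_same, one_smul]
  rw [← h2, h1, map_zero, mul_zero]

/-- The entries of `J G⁻¹ Jᵀ` are the values at `v` of the invariants `ηⱼ(pᵢ) = (dpᵢ, dpⱼ)`, which are
homogeneous of degree `mᵢ + mⱼ`. If `v` is an eigenvector of some `w ∈ W` with eigenvalue `ζ`, then
these values are unchanged when they are multiplied by `ζ ^ (mᵢ + mⱼ)`. -/
theorem metric_eq_pow_mul (hp : IsBasicInvariants W p m) (hG : IsInvariantInnerProduct W G)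
    {w : GL (Fin ℓ) ℝ} (hw : w ∈ W) {v : Fin ℓ → ℂ} {ζ : ℂ} (hζ : ζ ≠ 0)
    (h : complexMatrix (w : Matrix (Fin ℓ) (Fin ℓ) ℝ) *ᵥ v = ζ • v) (i j : Fin ℓ) :
    (jacobianAt p v * complexMatrix G⁻¹ * (jacobianAt p v)ᵀ) i j =
      ζ ^ (m i + m j) * (jacobianAt p v * complexMatrix G⁻¹ * (jacobianAt p v)ᵀ) i j := by
  set A := complexMatrix ((w⁻¹ : GL (Fin ℓ) ℝ) : Matrix (Fin ℓ) (Fin ℓ) ℝ) with hA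
  set J := jacobianAt p v with hJdef
  have hJ : J * A = diagonal (fun i => ζ ^ m i) * J := by
    ext i a
    rw [diagonal_mul, mul_apply]
    have h1 := congrArg (eval v) (pderiv_contragredient w (p i) a)
    rw [hp.mem_invariants i w hw, map_sum] at h1
    have h2 : ∀ b, eval v (contragredient w (pderiv b (p i))) =
        (ζ⁻¹) ^ m i * J i b := by
      intro b
      rw [eval_contragredient, complexMatrix_inv_mulVec hζ h,
        eval_smul_of_isHomogeneous (hp.isHomogeneous i).pderiv]
      rfl
    simp only [map_mul, h2, eval_C] at h1
    change ∑ b, J i b * A b a = ζ ^ m i * eval v (pderiv a (p i))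
    rw [h1, Finset.mul_sum]
    refine Finset.sum_congr rfl fun b _ => ?_
    rw [← mul_assoc, ← mul_assoc, ← mul_pow, mul_inv_cancel₀ hζ, one_pow, one_mul]
    rfl
  have hAG : A * complexMatrix G⁻¹ * Aᵀ = complexMatrix G⁻¹ := by
    have hGu : IsUnit G.det := (isUnit_iff_isUnit_det G).1 hG.posDef.isUnit
    have h1 := hG.invariant w hw
    have h3 : ((w⁻¹ : GL (Fin ℓ) ℝ) : Matrix (Fin ℓ) (Fin ℓ) ℝ) * G⁻¹ *
        ((w⁻¹ : GL (Fin ℓ) ℝ) : Matrix (Fin ℓ) (Fin ℓ) ℝ)ᵀ = G⁻¹ := by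
      rw [coe_units_inv]
      nth_rewrite 2 [← h1]
      rw [Matrix.mul_inv_rev, Matrix.mul_inv_rev, transpose_nonsing_inv, Matrix.mul_assoc]
    have h4 : Aᵀ = complexMatrix ((w⁻¹ : GL (Fin ℓ) ℝ) : Matrix (Fin ℓ) (Fin ℓ) ℝ)ᵀ :=
      transpose_map.symm
    rw [h4, hA, ← complexMatrix_mul, ← complexMatrix_mul, h3]
  have hK : J * complexMatrix G⁻¹ * Jᵀ =
      diagonal (fun i => ζ ^ m i) * (J * complexMatrix G⁻¹ * Jᵀ) *
        diagonal (fun i => ζ ^ m i) := by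
    calc J * complexMatrix G⁻¹ * Jᵀ = J * (A * complexMatrix G⁻¹ * Aᵀ) * Jᵀ := by rw [hAG]
      _ = (J * A) * complexMatrix G⁻¹ * (J * A)ᵀ := by
        rw [transpose_mul]; simp only [Matrix.mul_assoc]
      _ = _ := by
        rw [hJ, transpose_mul, diagonal_transpose]; simp only [Matrix.mul_assoc]
  have := congrFun (congrFun hK i) j
  rw [mul_diagonal, diagonal_mul] at this
  rw [pow_add]
  linear_combination this

/-- Evaluate the coefficients `ηⱼ(∂ₖ pᵢ)` of `Hess(pᵢ)(ηⱼ)` at `v` and contract with `v`: by Euler's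
identity the result is `mᵢ ηⱼ(pᵢ)(v)`. -/
theorem sum_mul_eval_gradField (hp : IsBasicInvariants W p m) (v : Fin ℓ → ℂ) (i j : Fin ℓ) :
    ∑ k, v k * eval v (gradField G (p j) (pderiv k (p i))) =
      m i * (jacobianAt p v * complexMatrix G⁻¹ * (jacobianAt p v)ᵀ) i j := by
  set J := jacobianAt p v with hJ
  have hsymm : ∀ a k, pderiv a (pderiv k (p i)) = pderiv k (pderiv a (p i)) := fun a k => by
    let D : Fin ℓ → Derivation ℂ (MvPolynomial (Fin ℓ) ℂ) (MvPolynomial (Fin ℓ) ℂ) := pderiv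
    have h0 : ⁅D a, D k⁆ = 0 := by
      ext1 b
      simp [D, Derivation.commutator_apply, pderiv_X, Pi.single_apply, apply_ite]
    have h1 := Derivation.congr_fun h0 (p i)
    rw [Derivation.commutator_apply, Derivation.zero_apply] at h1
    exact sub_eq_zero.1 h1
  have heuler : ∀ a, ∑ k, v k * eval v (pderiv k (pderiv a (p i))) = m i * J i a := by
    intro a
    have h1 := congrArg (eval v) (hp.isHomogeneous i |>.pderiv (i := a)).sum_X_mul_pderiv
    rw [map_sum, map_nsmul, nsmul_eq_mul, Nat.add_sub_cancel] at h1
    simp only [map_mul, eval_X] at h1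
    exact h1
  simp only [gradField_apply, map_sum, map_mul, eval_C, hsymm _ _]
  calc ∑ k, v k * ∑ a, (∑ s, ((G⁻¹ a s : ℝ) : ℂ) * J j s) * eval v (pderiv k (pderiv a (p i)))
      = ∑ a, (∑ s, ((G⁻¹ a s : ℝ) : ℂ) * J j s) *
          ∑ k, v k * eval v (pderiv k (pderiv a (p i))) := by
        simp only [Finset.mul_sum]
        rw [Finset.sum_comm]
        exact Finset.sum_congr rfl fun a _ => Finset.sum_congr rfl fun k _ => by ring
    _ = m i * ∑ a, J i a * ∑ s, ((G⁻¹ a s : ℝ) : ℂ) * J j s := by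
        rw [Finset.mul_sum]
        exact Finset.sum_congr rfl fun a _ => by rw [heuler]; ring
    _ = _ := by
        rw [Matrix.mul_assoc, mul_apply]
        rfl

/-- Nondegeneracy of the metric at a regular eigenvector. The exponents come in pairs with sum
divisible by `n`, and `2 ∑ mᵢ ≤ ℓ n` forces each of these sums to be `n`. -/
theorem exists_dual_exponent [NeZero ℓ] (hp : IsBasicInvariants W p m)
    (hG : IsInvariantInnerProduct W G) (hm : ∀ i, 0 < m i) {w : GL (Fin ℓ) ℝ} (hw : w ∈ W)
    {v : Fin ℓ → ℂ} {ζ : ℂ} {n : ℕ} (hζ : IsPrimitiveRoot ζ n) (hn : 0 < n)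
    (h : complexMatrix (w : Matrix (Fin ℓ) (Fin ℓ) ℝ) *ᵥ v = ζ • v)
    (hdet : (jacobianAt p v).det ≠ 0) (hsum : 2 * ∑ i, m i ≤ ℓ * n) (j : Fin ℓ) :
    ∃ i, m i + m j = n ∧
      (jacobianAt p v * complexMatrix G⁻¹ * (jacobianAt p v)ᵀ) i j ≠ 0 := by
  set K := jacobianAt p v * complexMatrix G⁻¹ * (jacobianAt p v)ᵀ with hK
  have hKdet : K.det ≠ 0 := by
    rw [hK, det_mul, det_mul, det_transpose]
    refine mul_ne_zero (mul_ne_zero hdet ?_) hdet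
    have h1 : (complexMatrix G⁻¹).det = Complex.ofRealHom (G⁻¹).det :=
      (RingHom.map_det Complex.ofRealHom G⁻¹).symm
    rw [h1, map_ne_zero]
    exact ((isUnit_iff_isUnit_det _).1 hG.posDef.inv.isUnit).ne_zero
  rw [det_apply] at hKdet
  obtain ⟨σ, -, hσ⟩ := Finset.exists_ne_zero_of_sum_ne_zero hKdet
  have hσ' : ∀ i, K (σ i) i ≠ 0 := by
    intro i hi
    have h0 : ∏ i, K (σ i) i = 0 := Finset.prod_eq_zero (Finset.mem_univ i) hi
    exact hσ (by rw [h0, smul_zero])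
  have hge : ∀ i, n ≤ m (σ i) + m i := by
    intro i
    refine Nat.le_of_dvd (Nat.add_pos_right _ (hm i)) (hζ.dvd_of_pow_eq_one _ ?_)
    have h1 := hp.metric_eq_pow_mul hG hw (hζ.ne_zero hn.ne') h (σ i) i
    rw [← hK] at h1
    exact mul_right_cancel₀ (hσ' i) (by rw [one_mul, ← h1])
  have htot : ∑ i, (m (σ i) + m i) ≤ ∑ _i : Fin ℓ, n := by
    rw [Finset.sum_add_distrib, Equiv.sum_comp σ m, Finset.sum_const, Finset.card_univ,
      Fintype.card_fin, smul_eq_mul, ← two_mul]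
    exact hsum
  have heq := (Finset.sum_eq_sum_iff_of_le fun i _ => hge i).1
    (le_antisymm (Finset.sum_le_sum fun i _ => hge i) htot)
  exact ⟨σ j, (heq j (Finset.mem_univ j)).symm, hσ' j⟩

/-- The largest exponent is `n - 1`: some basic invariant does not vanish at the eigenvector. -/
theorem top_exponent [NeZero ℓ] (hp : IsBasicInvariants W p m)
    (hm : ∀ i, 0 < m i) {w : GL (Fin ℓ) ℝ} (hw : w ∈ W)
    {v : Fin ℓ → ℂ} {ζ : ℂ} {n : ℕ} (hζ : IsPrimitiveRoot ζ n)
    (h : complexMatrix (w : Matrix (Fin ℓ) (Fin ℓ) ℝ) *ᵥ v = ζ • v)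
    (hdet : (jacobianAt p v).det ≠ 0) (hdual : ∀ j, ∃ i, m i + m j = n) : m ⊤ + 1 = n := by
  have hv : v ≠ 0 := by
    rintro rfl
    refine hdet ?_
    have h0 : jacobianAt p (0 : Fin ℓ → ℂ) = 0 := by
      ext i a
      have h1 := eval_smul_of_isHomogeneous (hp.isHomogeneous i |>.pderiv (i := a)) 0 0
      rw [zero_smul, Nat.add_sub_cancel, zero_pow (hm i).ne', zero_mul] at h1
      exact h1
    rw [h0, det_zero]
  obtain ⟨k, hk⟩ : ∃ k, eval v (p k) ≠ 0 := by
    by_contra! hall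
    refine hv (eq_zero_of_mulVec_eq_zero hdet ?_)
    ext k
    have h1 := congrArg (eval v) (hp.isHomogeneous k).sum_X_mul_pderiv
    rw [map_nsmul, hall k, smul_zero, map_sum] at h1
    rw [mulVec, dotProduct, Pi.zero_apply, ← h1]
    exact Finset.sum_congr rfl fun a _ => by
      rw [map_mul, eval_X, mul_comm]
      rfl
  have hdvd : n ∣ m k + 1 := by
    refine hζ.dvd_of_pow_eq_one _ (mul_right_cancel₀ hk ?_)
    rw [← eval_smul_of_isHomogeneous (hp.isHomogeneous k),
      eval_smul_of_mem_invariants (hp.mem_invariants k) hw h, one_mul]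
  have h1 := Nat.le_of_dvd (Nat.succ_pos _) hdvd
  have h2 := hp.monotone (le_top : k ≤ ⊤)
  obtain ⟨i, hi⟩ := hdual ⊤
  have h3 := hm i
  omega

end IsBasicInvariants

/-- The Hessian rank condition for every irreducible finite reflection group. -/
theorem hessianRankCondition [NeZero ℓ] {p : Fin ℓ → MvPolynomial (Fin ℓ) ℂ} {m : Fin ℓ → ℕ}
    (hW : IsReflectionGroup W) (hirr : IsIrreducible W) (hG : IsInvariantInnerProduct W G)
    (hp : IsBasicInvariants W p m) : HessianRankCondition W G p m := by
  intro j
  obtain ⟨w, hw, n, v, ζ, hζ, hn, hv, hreg, hcard⟩ := exists_regular_eigenvector hG hW hirr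
  obtain ⟨P, hP, hP', hPcard⟩ := exists_positive_roots hG hW.finite
  have hm := hp.exponent_pos hG hW hirr
  have hsum : 2 * ∑ i, m i ≤ ℓ * n := by
    have := hp.sum_le_card hG hW.finite hP hP'
    omega
  have hdet : (jacobianAt p v).det ≠ 0 := by
    have h1 : (jacobianAt p v).det = eval v (jacobianDet p) := by
      rw [jacobianDet, RingHom.map_det]
      rfl
    rw [h1]
    intro h0
    obtain ⟨g, hg⟩ := hp.jacobianDet_dvd_prod_roots hG hW.finite hP
    have h2 := congrArg (eval v) hg
    rw [map_mul, h0, zero_mul, map_prod, Finset.prod_eq_zero_iff] at h2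
    obtain ⟨β, hβ, hβ0⟩ := h2
    exact hreg β (hP' β hβ) hβ0
  have hdual := hp.exists_dual_exponent hG hm hw hζ hn hv hdet hsum
  have htop := hp.top_exponent hm hw hζ hv hdet fun j => (hdual j).imp fun i hi => hi.1
  obtain ⟨i, hij, hK⟩ := hdual j
  refine ⟨i, hij.trans htop.symm, fun hmem => hK ?_⟩
  -- The coefficients of `Hess(pᵢ)(ηⱼ)` have degree `mᵢ + mⱼ - 1 < n`.
  have hzero : ∀ k, eval v (gradField G (p j) (pderiv k (p i))) = 0 := by
    intro k
    have hhom : (gradField G (p j) (pderiv k (p i))).IsHomogeneous (m j + (m i - 1)) := by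
      rw [gradField_apply]
      refine IsHomogeneous.sum _ _ _ fun a _ => IsHomogeneous.mul ?_ ?_
      · exact IsHomogeneous.sum _ _ _ fun s _ => ((hp.isHomogeneous j).pderiv).C_mul _
      · exact ((hp.isHomogeneous i).pderiv (i := k)).pderiv
    have := hm i
    exact eval_eq_zero_of_mem_invariantIdeal (apply_pderiv_mem_of_hess_mem hmem k) hhom
      (by omega) hw hζ hv
  have heuler := hp.sum_mul_eval_gradField (G := G) v i j
  simp only [hzero, mul_zero, Finset.sum_const_zero] at heuler
  refine (mul_eq_zero.1 heuler.symm).resolve_left ?_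
  exact_mod_cast (hm i).ne'

end HessianRank

end CoxeterArrangement

end

theorem theorem221 (ℓ : ℕ) [NeZero ℓ] (W : Subgroup (GL (Fin ℓ) ℝ))
    (hW : CoxeterArrangement.IsReflectionGroup W) (hirr : CoxeterArrangement.IsIrreducible W)
    (G : Matrix (Fin ℓ) (Fin ℓ) ℝ) (hG : CoxeterArrangement.IsInvariantInnerProduct W G)
    (hE₆ : ¬ CoxeterArrangement.IsOfType W G CoxeterMatrix.E₆)
    (hE₇ : ¬ CoxeterArrangement.IsOfType W G CoxeterMatrix.E₇)
    (hE₈ : ¬ CoxeterArrangement.IsOfType W G CoxeterMatrix.E₈)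
    (p : Fin ℓ → MvPolynomial (Fin ℓ) ℂ) (m : Fin ℓ → ℕ)
    (hp : CoxeterArrangement.IsBasicInvariants W p m) :
    CoxeterArrangement.HessianRankCondition W G p m :=
  CoxeterArrangement.hessianRankCondition hW hirr hG hp
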